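/- **Setting.** Let $\aleph_0\le\lambda<\mu\le\infty$ and let $\tau$ be a vocabulary whose function and predicate symbols have (possibly infinite) arity $\le\lambda$. An *ess-$[\lambda,\mu)$-AEC* is a class $K$ of $\tau$-models with a partial order $\le$ on $K$, refining "is a submodel of", both closed under isomorphism, such that every $M\in K$ has cardinality $\|M\|\in[\lambda,\mu)$ and: (III$_1$) if $\langle M_i:i<\delta\rangle$ ($\delta$ a limit ordinal) is $\le$-increasing and $|\bigcup_{i<\delta}M_i|<\mu$, there is a unique $M\in K$ with universe $\bigcup_{i<\delta}|M_i|$ and $M_i\le M$ for all $i<\delta$; (III$_2$) if moreover $M_i\le N$ for all $i<\delta$, then $M\le N$; (IV) if $M_1\subseteq M_2$, $M_1\le N$ and $M_2\le N$, then $M_1\le M_2$; (V) if $A\subseteq N\in K$, there is $M\le N$ with $A\subseteq M$ and $\|M\|\le\lambda+|A|$. A $\le$-embedding of $M$ into $N$ is an isomorphism of $M$ onto some $M'\le N$. The orbital type $\mathrm{ortp}(a,M,N)$ ($M\le N$, $a\in N$) is the class of $(M,N,a)$ under the transitive closure of the relation "$(M,N_1,a_1)$, $(M,N_2,a_2)$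 are such that for some $N\in K$ there are $\le$-embeddings $f_\ell:N_\ell\to N$ over $M$ with $f_1(a_1)=f_2(a_2)$"; $\mathcal S(M)$ is the set of orbital types over $M$. A *good ess-$[\lambda,\mu)$-frame* $\mathfrak s$ consists of an ess-$[\lambda,\infty)$-AEC $\mathfrak K[\mathfrak s]$, its restriction $(K_{\mathfrak s},\le_{\mathfrak s})$ to models of cardinality $<\mu$ (an ess-$[\lambda,\mu)$-AEC), sets $\mathcal S^{\mathrm{bs}}(M)\subseteq\mathcal S(M)$ of basic types for $M\in K_{\mathfrak s}$, and a relation "$\mathrm{ortp}(a,M_1,M_3)$ does not fork over $M_0$" (written $\mathrm{NF}(M_0,M_1,a,M_3)$), such that, all models below being in $K_{\mathfrak s}$: 1. $\{M\in K_{\mathfrak s}:\|M\|=\lambda\}$ has at most $2^\lambda$ isomorphism types; for every cardinal $\chi\in[\lambda,\mu)$ there is a superlimit model $M$ in $\chi$ (that is, $\|M\|=\chi$; every model of cardinality $\chi$ embeds into $M$; every $N\ge_{\mathfrak s}M$ of cardinality $\chi$ has a proper $\le_{\mathfrak s}$-extension isomorphic to $M$; unions of increasing chains, of limit length $<\chi^+$,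 of models isomorphic to $M$ are isomorphic to $M$); $K_{\mathfrak s}$ has amalgamation, joint embedding and no maximal model. 2. $\mathcal S^{\mathrm{bs}}$ is closed under isomorphism; basic types are not algebraic; if $M<_{\mathfrak s}N$ then $\mathrm{ortp}(a,M,N)\in\mathcal S^{\mathrm{bs}}(M)$ for some $a\in N\setminus M$; $|\mathcal S^{\mathrm{bs}}(M)|\le\|M\|$. 3. $\mathrm{NF}(M_0,M_1,a,M_3)$ is preserved under isomorphism and implies $M_0\le_{\mathfrak s}M_1\le_{\mathfrak s}M_3$, $a\in M_3\setminus M_1$ and that $\mathrm{ortp}(a,M_0,M_3)$ and $\mathrm{ortp}(a,M_1,M_3)$ are basic; $\mathrm{NF}(M_0,M_0,a,M_3)$ iff $\mathrm{ortp}(a,M_0,M_3)$ is basic. 4. Monotonicity: if $M_0\le_{\mathfrak s}M_0'\le_{\mathfrak s}M_1'\le_{\mathfrak s}M_1\le_{\mathfrak s}M_3\le_{\mathfrak s}M_3'$, $M_1'\cup\{a\}\subseteq M_3''\le_{\mathfrak s}M_3'$ and $\mathrm{NF}(M_0,M_1,a,M_3)$, then $\mathrm{NF}(M_0',M_1',a,M_3')$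 and $\mathrm{NF}(M_0',M_1',a,M_3'')$. 5. Local character: if $\langle M_i:i\le\delta+1\rangle$ is increasing, continuous at limits $\le\delta$ ($\delta$ limit), and $\mathrm{ortp}(a,M_\delta,M_{\delta+1})$ is basic, then it does not fork over $M_i$ for all large enough $i<\delta$. Transitivity: if $M_0\le_{\mathfrak s}M_0'\le_{\mathfrak s}M_0''\le_{\mathfrak s}M_3$, $\mathrm{NF}(M_0',M_0'',a,M_3)$ and $\mathrm{NF}(M_0,M_0',a,M_3)$, then $\mathrm{NF}(M_0,M_0'',a,M_3)$. Uniqueness: two types over $M_1$ that do not fork over $M_0$ and have equal restrictions to $M_0$ are equal. Extension: if $M\le_{\mathfrak s}N$, every $p\in\mathcal S^{\mathrm{bs}}(M)$ has an extension in $\mathcal S^{\mathrm{bs}}(N)$ that does not fork over $M$. Continuity: if $\langle M_i:i\le\delta\rangle$ is increasing continuous ($\delta$ limit), $p\in\mathcal S(M_\delta)$ and every $p\restriction M_i$, $i<\delta$, is basic and does not fork over $M_0$, then so is and does $p$. 6. Symmetry: if $a_1,a_2\in M_3$ have basic types over $M_0\le_{\mathfrak s}M_3$, then there are $M_1,M_3'$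 with $M_0\le_{\mathfrak s}M_1\le_{\mathfrak s}M_3'$, $M_3\le_{\mathfrak s}M_3'$, $a_1\in M_1$ and $\mathrm{NF}(M_0,M_1,a_2,M_3')$ iff the same holds with $a_1,a_2$ exchanged. 7. Non-forking amalgamation: if $M_0\le_{\mathfrak s}M_\ell$, $a_\ell\in M_\ell\setminus M_0$ and $\mathrm{ortp}(a_\ell,M_0,M_\ell)$ is basic ($\ell=1,2$), then there are $M_3\ge_{\mathfrak s}M_0$ and $\le_{\mathfrak s}$-embeddings $f_\ell:M_\ell\to M_3$ over $M_0$ such that $\mathrm{ortp}(f_\ell(a_\ell),f_{3-\ell}(M_{3-\ell}),M_3)$ does not fork over $M_0$ for $\ell=1,2$. If $M\le_{\mathfrak s}N$ have the same cardinality $\chi$, $N$ is *universal* over $M$ if every $N'\ge_{\mathfrak s}M$ of cardinality $\chi$ embeds into $N$ over $M$, and $N$ is *brimmed* over $M$ if for some regular cardinal $\theta\le\chi$, $N$ is the union of a $\le_{\mathfrak s}$-increasing continuous chain $\langle N_i:i<\theta\rangle$ with $N_0=M$ and each $N_{i+1}$ universal over $N_i$. **Claim.** Let $\mathfrak s$ be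 a good ess-$[\lambda,\mu)$-frame. Then there exist $\mathfrak C$ (called a $\mu$-saturated monster for $K_{\mathfrak s}$) and $\langle M_\alpha:\alpha<\mu\rangle$ such that: (a) $\mathfrak C$ is a $\tau$-model of cardinality $\le\mu$; (b) $\langle M_\alpha:\alpha<\mu\rangle$ is a $\le_{\mathfrak s}$-increasing continuous sequence of members of $K_{\mathfrak s}$ and $\mathfrak C$ is its union, i.e. $|\mathfrak C|=\bigcup_{\alpha<\mu}|M_\alpha|$, each $M_\alpha$ is a submodel of $\mathfrak C$, and, if $\mu<\infty$, $\mathfrak C\in\mathfrak K[\mathfrak s]$ and $M_\alpha\le_{\mathfrak K[\mathfrak s]}\mathfrak C$ for every $\alpha<\mu$; (c) every $M\in K_{\mathfrak s}$ is $\le_{\mathfrak s}$-embeddable into some $M_\alpha$; (d) $M_{\alpha+1}$ is brimmed over $M_\alpha$ for every $\alpha<\mu$. (If $\mu=\infty$, then $\alpha$ ranges over all ordinals and $\mathfrak C$ may be a proper class.) -/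

import Mathlib

open Cardinal

universe u

/-- A vocabulary: a set of function symbols and a set of predicate symbols, where the arity of a
symbol is an arbitrary (possibly infinite) index set. -/
structure Vocab where
  Fn : Type u
  Rel : Type u
  fnArity : Fn → Type u
  relArity : Rel → Type u

/-- A `τ`-model. Its universe is a collection of sets in the sense of ZFC, so that inclusions and
unions of models are literal. The universe is a set (rather than a proper class) iff its
cardinality is `< Cardinal.univ.{u, u+1}`. -/
structure Model (τ : Vocab.{u}) where
  carrier : Set ZFSet.{u}
  fn : (F : τ.Fn) → (τ.fnArity F → carrier) → carrier
  rel : (R : τ.Rel) → (τ.relArity R → carrier) → Prop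

namespace Model

variable {τ : Vocab.{u}}

/-- The cardinality `‖M‖`. -/
noncomputable def card (M : Model τ) : Cardinal.{u + 1} := #M.carrier

/-- The restriction of `f` to `M` is an embedding of `τ`-models from `M` into `N`
(an isomorphism onto a submodel). The values of `f` outside of `M` are irrelevant. -/
structure IsEmbedding (f : ZFSet.{u} → ZFSet.{u}) (M N : Model τ) : Prop where
  mapsTo : Set.MapsTo f M.carrier N.carrier
  injOn : Set.InjOn f M.carrier
  map_fn : ∀ (F : τ.Fn) (x : τ.fnArity F → M.carrier) (y : τ.fnArity F → N.carrier),
    (∀ i, f (x i) = y i) → f (M.fn F x) = N.fn F y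
  map_rel : ∀ (R : τ.Rel) (x : τ.relArity R → M.carrier) (y : τ.relArity R → N.carrier),
    (∀ i, f (x i) = y i) → (M.rel R x ↔ N.rel R y)

/-- The restriction of `f` to `M` is an isomorphism from `M` onto `N`. -/
structure IsIso (f : ZFSet.{u} → ZFSet.{u}) (M N : Model τ) : Prop
    extends IsEmbedding f M N where
  surjOn : Set.SurjOn f M.carrier N.carrier

/-- `M` and `N` are isomorphic. -/
def Isomorphic (M N : Model τ) : Prop := ∃ f, IsIso f M N

/-- `M ⊆ N`: `M` is a submodel of `N`. -/
def IsSub (M N : Model τ) : Prop := IsEmbedding id M N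

/-- `f` is the identity on `M`. -/
def FixesOn (f : ZFSet.{u} → ZFSet.{u}) (M : Model τ) : Prop := ∀ x ∈ M.carrier, f x = x

end Model

/-- A class `K` of `τ`-models with a two-place relation `≤` on models. -/
structure AbstractClass (τ : Vocab.{u}) where
  K : Model τ → Prop
  le : Model τ → Model τ → Prop

namespace AbstractClass

open Model

variable {τ : Vocab.{u}}

/-- The sequence `⟨M i : i < δ⟩` consists of members of the class and is `≤`-increasing. -/
def IsIncreasing (k : AbstractClass τ) (δ : Ordinal.{u + 1})
    (M : Ordinal.{u + 1} → Model τ) : Prop :=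
  (∀ i < δ, k.K (M i)) ∧ ∀ i j, i ≤ j → j < δ → k.le (M i) (M j)

/-- The universe of `N` is the union of the universes of the `M i`, `i < δ`. -/
def IsUnionBelow (δ : Ordinal.{u + 1}) (M : Ordinal.{u + 1} → Model τ) (N : Model τ) : Prop :=
  N.carrier = ⋃ i ∈ Set.Iio δ, (M i).carrier

/-- The sequence `⟨M i : i < δ⟩` is `≤`-increasing continuous. -/
def IsContinuous (k : AbstractClass τ) (δ : Ordinal.{u + 1})
    (M : Ordinal.{u + 1} → Model τ) : Prop :=
  k.IsIncreasing δ M ∧ ∀ j < δ, Order.IsSuccLimit j → IsUnionBelow j M (M j)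

/-- Essentially `[lam, mu)`-AEC. The value `mu = Cardinal.univ.{u, u+1}`, for which `‖M‖ < mu`
just says that the universe of `M` is a set, is the case `mu = ∞`. -/
structure IsEssAEC (k : AbstractClass τ) (lam mu : Cardinal.{u + 1}) : Prop where
  aleph0_le : ℵ₀ ≤ lam
  lam_lt : lam < mu
  mu_le : mu ≤ Cardinal.univ.{u, u + 1}
  fnArity_le : ∀ F, Cardinal.lift.{u + 1} #(τ.fnArity F) ≤ lam
  relArity_le : ∀ R, Cardinal.lift.{u + 1} #(τ.relArity R) ≤ lam
  /-- `≤` is a relation on `K`, finer than being a submodel. -/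
  mem_left : ∀ {M N}, k.le M N → k.K M
  mem_right : ∀ {M N}, k.le M N → k.K N
  isSub : ∀ {M N}, k.le M N → IsSub M N
  /-- Closure under isomorphisms. -/
  iso_mem : ∀ {f M N}, IsIso f M N → k.K M → k.K N
  iso_le : ∀ {f M₁ N₁ M₂ N₂}, IsIso f N₁ N₂ → IsIso f M₁ M₂ → k.le M₁ N₁ → k.le M₂ N₂
  /-- Cardinalities of members. -/
  le_card : ∀ {M}, k.K M → lam ≤ M.card
  card_lt : ∀ {M}, k.K M → M.card < mu
  /-- `≤` is a partial order on `K`. -/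
  refl : ∀ {M}, k.K M → k.le M M
  trans : ∀ {M₁ M₂ M₃}, k.le M₁ M₂ → k.le M₂ M₃ → k.le M₁ M₃
  antisymm : ∀ {M N}, k.le M N → k.le N M → M = N
  /-- Unions of increasing chains. -/
  union : ∀ (δ : Ordinal.{u + 1}) (M : Ordinal.{u + 1} → Model τ), Order.IsSuccLimit δ →
    k.IsIncreasing δ M → #(⋃ i ∈ Set.Iio δ, (M i).carrier : Set ZFSet.{u}) < mu →
    ∃! N, k.K N ∧ IsUnionBelow δ M N ∧ ∀ i < δ, k.le (M i) N
  /-- Smoothness. -/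
  smooth : ∀ (δ : Ordinal.{u + 1}) (M : Ordinal.{u + 1} → Model τ), Order.IsSuccLimit δ →
    k.IsIncreasing δ M → ∀ N N', k.K N → IsUnionBelow δ M N → (∀ i < δ, k.le (M i) N) →
    (∀ i < δ, k.le (M i) N') → k.le N N'
  /-- Coherence. -/
  coherence : ∀ {M₁ M₂ N}, IsSub M₁ M₂ → k.le M₁ N → k.le M₂ N → k.le M₁ M₂
  /-- Downward Löwenheim–Skolem–Tarski. -/
  lst : ∀ (N : Model τ) (A : Set ZFSet.{u}), k.K N → A ⊆ N.carrier →
    ∃ M, A ⊆ M.carrier ∧ k.le M N ∧ M.card ≤ lam + #A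

/-- The class restricted to its models of cardinality `< mu`. -/
def below (k : AbstractClass τ) (mu : Cardinal.{u + 1}) : AbstractClass τ where
  K M := k.K M ∧ M.card < mu
  le M N := k.le M N ∧ M.card < mu ∧ N.card < mu

/-- `f` (restricted to `M`) is a `≤`-embedding of `M` into `N`: an isomorphism from `M` onto some
`M' ≤ N`. -/
def IsLeEmbedding (k : AbstractClass τ) (f : ZFSet.{u} → ZFSet.{u}) (M N : Model τ) : Prop :=
  ∃ M', IsIso f M M' ∧ k.le M' N

/-- Amalgamation. -/
def Amalgamation (k : AbstractClass τ) : Prop :=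
  ∀ M₀ M₁ M₂, k.le M₀ M₁ → k.le M₀ M₂ → ∃ N f₁ f₂,
    k.IsLeEmbedding f₁ M₁ N ∧ k.IsLeEmbedding f₂ M₂ N ∧ FixesOn f₁ M₀ ∧ FixesOn f₂ M₀

/-- Joint embedding. -/
def JointEmbedding (k : AbstractClass τ) : Prop :=
  ∀ M₁ M₂, k.K M₁ → k.K M₂ → ∃ N f₁ f₂, k.IsLeEmbedding f₁ M₁ N ∧ k.IsLeEmbedding f₂ M₂ N

/-- `M` is a superlimit model in the cardinality `χ`. -/
def IsSuperlimit (k : AbstractClass τ) (χ : Cardinal.{u + 1}) (M : Model τ) : Prop :=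
  k.K M ∧ M.card = χ ∧
  (∀ N, k.K N → N.card = χ → ∃ f, k.IsLeEmbedding f N M) ∧
  (∀ N, N.card = χ → k.le M N → ∃ M', Isomorphic M M' ∧ k.le N M' ∧ N ≠ M') ∧
  ∀ (δ : Ordinal.{u + 1}) (seq : Ordinal.{u + 1} → Model τ), Order.IsSuccLimit δ →
    δ < (Order.succ χ).ord → k.IsIncreasing δ seq → (∀ i < δ, Isomorphic M (seq i)) →
    ∀ N, k.K N → IsUnionBelow δ seq N → (∀ i < δ, k.le (seq i) N) → Isomorphic M N

/-- `N` is universal over `M`, both of the same cardinality. -/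
def IsUniversalOver (k : AbstractClass τ) (M N : Model τ) : Prop :=
  k.le M N ∧ N.card = M.card ∧
    ∀ N', k.le M N' → N'.card = M.card → ∃ f, k.IsLeEmbedding f N' N ∧ FixesOn f M

/-- `N` is brimmed over `M`: for `χ = ‖M‖ = ‖N‖` and some regular cardinal `θ ≤ χ`, `N` is
`(χ, θ)`-brimmed over `M`, i.e. `N` is the union of an increasing continuous chain of length `θ`
of models of cardinality `χ` that starts with `M` and in which every successor is universal over
its predecessor. -/
def IsBrimmedOver (k : AbstractClass τ) (M N : Model τ) : Prop :=
  k.le M N ∧ N.card = M.card ∧ ∃ θ : Cardinal.{u + 1}, θ.IsRegular ∧ θ ≤ M.card ∧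
    ∃ seq : Ordinal.{u + 1} → Model τ, k.IsContinuous θ.ord seq ∧ seq 0 = M ∧
      (∀ i < θ.ord, k.IsUniversalOver (seq i) (seq (Order.succ i))) ∧
      IsUnionBelow θ.ord seq N ∧ ∀ i < θ.ord, k.le (seq i) N

/-- Atomic equivalence of triples `(M, N₁, a₁)` and `(M, N₂, a₂)` with `M ≤ N_ℓ`, `a_ℓ ∈ N_ℓ`. -/
def AtEquiv (k : AbstractClass τ) (M : Model τ) (x y : Model τ × ZFSet.{u}) : Prop :=
  k.le M x.1 ∧ x.2 ∈ x.1.carrier ∧ k.le M y.1 ∧ y.2 ∈ y.1.carrier ∧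
  ∃ N f g, k.IsLeEmbedding f x.1 N ∧ k.IsLeEmbedding g y.1 N ∧
    FixesOn f M ∧ FixesOn g M ∧ f x.2 = g y.2

/-- The orbital type `ortp(a, M, N)`: the class of `(M, N, a)` under the transitive closure of
atomic equivalence. -/
def ortp (k : AbstractClass τ) (a : ZFSet.{u}) (M N : Model τ) : Set (Model τ × ZFSet.{u}) :=
  {y | Relation.TransGen (k.AtEquiv M) (N, a) y}

/-- The set `𝒮(M)` of orbital types over `M`. -/
def types (k : AbstractClass τ) (M : Model τ) : Set (Set (Model τ × ZFSet.{u})) :=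
  {p | ∃ N a, k.le M N ∧ a ∈ N.carrier ∧ p = k.ortp a M N}

end AbstractClass

open Model AbstractClass in
/-- Good ess-`[lam, mu)`-frame. -/
structure GoodEssFrame (τ : Vocab.{u}) (lam mu : Cardinal.{u + 1}) where
  /-- The class `𝔎[𝔰]`, an ess-`[lam, ∞)`-AEC. -/
  big : AbstractClass τ
  big_ess : big.IsEssAEC lam Cardinal.univ.{u, u + 1}
  /-- The class `𝔎_𝔰`: the models of `𝔎[𝔰]` of cardinality in `[lam, mu)`. -/
  cls : AbstractClass τ
  cls_eq : cls = big.below mu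
  cls_ess : cls.IsEssAEC lam mu
  /-- The basic types over a model. -/
  bs : Model τ → Set (Set (Model τ × ZFSet.{u}))
  /-- `nf M₀ M₁ a M₃`: the type `ortp(a, M₁, M₃)` does not fork over `M₀`. -/
  nf : Model τ → Model τ → ZFSet.{u} → Model τ → Prop
  /-- Few models of cardinality `lam` up to isomorphism. -/
  few_models : #((fun M => {N | cls.K N ∧ N.card = lam ∧ Isomorphic M N}) ''
    {M | cls.K M ∧ M.card = lam}) ≤ 2 ^ lam
  superlimit : ∀ χ, lam ≤ χ → χ < mu → ∃ M, cls.IsSuperlimit χ M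
  amalgamation : cls.Amalgamation
  jointEmbedding : cls.JointEmbedding
  no_maximal : ∀ M, cls.K M → ∃ N, cls.le M N ∧ M ≠ N
  /-- Basic types are orbital types, closed under isomorphisms. -/
  bs_subset : ∀ M, cls.K M → bs M ⊆ cls.types M
  bs_iso : ∀ f M N M' N' a, cls.le M N → cls.le M' N' → a ∈ N.carrier → IsIso f N N' →
    IsIso f M M' → cls.ortp a M N ∈ bs M → cls.ortp (f a) M' N' ∈ bs M'
  /-- Basic types are not algebraic. -/
  bs_nonalg : ∀ M N a, cls.le M N → a ∈ N.carrier → cls.ortp a M N ∈ bs M → a ∉ M.carrier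
  /-- Density of basic types. -/
  bs_density : ∀ M N, cls.le M N → M ≠ N →
    ∃ a ∈ N.carrier, a ∉ M.carrier ∧ cls.ortp a M N ∈ bs M
  /-- Stability for basic types. -/
  bs_stability : ∀ M, cls.K M → #(bs M) ≤ M.card
  nf_dom : ∀ {M₀ M₁ a M₃}, nf M₀ M₁ a M₃ → cls.le M₀ M₁ ∧ cls.le M₁ M₃ ∧ a ∈ M₃.carrier ∧
    a ∉ M₁.carrier ∧ cls.ortp a M₀ M₃ ∈ bs M₀ ∧ cls.ortp a M₁ M₃ ∈ bs M₁
  nf_iso : ∀ f M₀ M₁ M₃ N₀ N₁ N₃ a, IsIso f M₃ N₃ → IsIso f M₁ N₁ → IsIso f M₀ N₀ →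
    nf M₀ M₁ a M₃ → nf N₀ N₁ (f a) N₃
  nf_base : ∀ M₀ M₃ a, cls.le M₀ M₃ → a ∈ M₃.carrier →
    (nf M₀ M₀ a M₃ ↔ cls.ortp a M₀ M₃ ∈ bs M₀)
  /-- Monotonicity. -/
  nf_mono : ∀ M₀ M₀' M₁' M₁ M₃ M₃' M₃'' a, cls.le M₀ M₀' → cls.le M₀' M₁' → cls.le M₁' M₁ →
    cls.le M₁ M₃ → cls.le M₃ M₃' → cls.le M₃'' M₃' → M₁'.carrier ⊆ M₃''.carrier →
    a ∈ M₃''.carrier → nf M₀ M₁ a M₃ →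
      nf M₀' M₁' a M₃' ∧ (nf M₀' M₁' a M₃' ↔ nf M₀' M₁' a M₃'')
  /-- Local character. -/
  nf_local : ∀ (δ : Ordinal.{u + 1}) (M : Ordinal.{u + 1} → Model τ) (N : Model τ) (a : ZFSet.{u}),
    Order.IsSuccLimit δ → cls.IsContinuous (Order.succ δ) M → cls.le (M δ) N → a ∈ N.carrier →
    cls.ortp a (M δ) N ∈ bs (M δ) → ∃ i < δ, ∀ j, i ≤ j → j < δ → nf (M j) (M δ) a N
  /-- Transitivity. -/
  nf_trans : ∀ M₀ M₀' M₀'' M₃ a, cls.le M₀ M₀' → cls.le M₀' M₀'' → cls.le M₀'' M₃ →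
    a ∈ M₃.carrier → nf M₀' M₀'' a M₃ → nf M₀ M₀' a M₃ → nf M₀ M₀'' a M₃
  /-- Uniqueness of non-forking extensions: two types over `M₁` that do not fork over `M₀` and
  have the same restriction to `M₀` are equal. -/
  nf_unique : ∀ M₀ M₁ N a N' a', nf M₀ M₁ a N → nf M₀ M₁ a' N' →
    cls.ortp a M₀ N = cls.ortp a' M₀ N' → cls.ortp a M₁ N = cls.ortp a' M₁ N'
  /-- Symmetry. -/
  nf_symm : ∀ M₀ M₃ a₁ a₂, cls.le M₀ M₃ → a₁ ∈ M₃.carrier → a₂ ∈ M₃.carrier →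
    cls.ortp a₁ M₀ M₃ ∈ bs M₀ → cls.ortp a₂ M₀ M₃ ∈ bs M₀ →
    ((∃ M₁ M₃', cls.le M₀ M₁ ∧ cls.le M₁ M₃' ∧ a₁ ∈ M₁.carrier ∧ cls.le M₃ M₃' ∧
        nf M₀ M₁ a₂ M₃') ↔
      ∃ M₂ M₃', cls.le M₀ M₂ ∧ cls.le M₂ M₃' ∧ a₂ ∈ M₂.carrier ∧ cls.le M₃ M₃' ∧
        nf M₀ M₂ a₁ M₃')
  /-- Existence of non-forking extensions. -/
  nf_extension : ∀ M N, cls.le M N → ∀ p ∈ bs M, ∃ N' a, nf M N a N' ∧ cls.ortp a M N' = p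
  /-- Continuity. -/
  nf_continuity : ∀ (δ : Ordinal.{u + 1}) (M : Ordinal.{u + 1} → Model τ) (N : Model τ)
    (a : ZFSet.{u}), Order.IsSuccLimit δ → cls.IsContinuous (Order.succ δ) M →
    cls.le (M δ) N → a ∈ N.carrier → (∀ i < δ, nf (M 0) (M i) a N) → nf (M 0) (M δ) a N
  /-- Non-forking amalgamation. -/
  nf_amalgamation : ∀ M₀ M₁ M₂ a₁ a₂, cls.le M₀ M₁ → cls.le M₀ M₂ →
    a₁ ∈ M₁.carrier → a₁ ∉ M₀.carrier → a₂ ∈ M₂.carrier → a₂ ∉ M₀.carrier →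
    cls.ortp a₁ M₀ M₁ ∈ bs M₀ → cls.ortp a₂ M₀ M₂ ∈ bs M₀ →
    ∃ M₃ N₁ N₂ f₁ f₂, cls.le M₀ M₃ ∧ cls.le N₁ M₃ ∧ cls.le N₂ M₃ ∧
      IsIso f₁ M₁ N₁ ∧ IsIso f₂ M₂ N₂ ∧ FixesOn f₁ M₀ ∧ FixesOn f₂ M₀ ∧
      nf M₀ N₂ (f₁ a₁) M₃ ∧ nf M₀ N₁ (f₂ a₂) M₃

/-! The monster is the union of a continuous chain of length `mu` in which every successor is both
brimmed and universal over its predecessor. Everything rests on one fact: each `M` in the class has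
a universal extension of its own cardinality `χ` (`exists_isUniversalOver`). An `ω`-chain of
universal extensions is then brimmed over `M`, and it inherits universality from its first step.

For the fact, stability for basic types gives a continuous chain `M_i`, `i ≤ χ·ω`, of models of size
`χ` with `M_0 = M` and each `M_{i+1}` realizing all basic types over `M_i`. Given `N ≥ M` of size
`χ`, build extensions `N_i` of `N` and coherent embeddings `f_i : M_i → N_i`. At stage `χ·n + r` the
`r`-th point of `N_{χ·n}` is put into the range of the next embedding, provided its type over the
current range is basic. The last embedding is onto: otherwise, by density, some point outside its
range has a basic type over it. By local character and monotonicity that type is already basic over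
all late ranges, so the point was absorbed at its turn. The inverse of `f_{χ·ω}` embeds `N` over `M`
(`isUniversalOver_of_chain`).

For embedding an arbitrary `N` in the class into the chain: universal extensions are proper, so
`M_α` has size at least `|α|`. With `α = ‖N‖`, joint embedding and Löwenheim–Skolem give a common
extension of `M_α` and a copy of `N` of size `‖M_α‖`, which `M_{α+1}` absorbs. -/

/-! ### Isomorphisms and renaming of models. -/

theorem ZFSet.univ_le_mk : Cardinal.univ.{u, u + 1} ≤ #ZFSet.{u} := by
  rw [← Cardinal.mk_ordinal]
  exact Cardinal.mk_le_of_injective Ordinal.toZFSet_injective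

/-- A set-sized collection can be moved injectively away from another one. -/
theorem ZFSet.exists_injOn_disjoint (A B : Set ZFSet.{u}) (hA : #A < Cardinal.univ.{u, u + 1})
    (hB : #B < Cardinal.univ.{u, u + 1}) :
    ∃ g : ZFSet.{u} → ZFSet.{u}, Set.InjOn g B ∧ ∀ x ∈ B, g x ∉ A := by
  have hinf : Infinite ZFSet.{u} := by
    rw [Cardinal.infinite_iff]
    exact Cardinal.aleph0_lt_univ.le.trans ZFSet.univ_le_mk
  -- `A` is smaller than the universe of all sets, so its complement still has full size and has
  -- room for `B`.
  have h1 : #(Aᶜ : Set ZFSet.{u}) = #ZFSet.{u} :=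
    Cardinal.mk_compl_of_infinite A (hA.trans_le ZFSet.univ_le_mk)
  have h2 : #B ≤ #(Aᶜ : Set ZFSet.{u}) := by
    rw [h1]; exact (hB.trans_le ZFSet.univ_le_mk).le
  obtain ⟨e⟩ := Cardinal.le_def _ _ |>.1 h2
  classical
  refine ⟨fun x => if h : x ∈ B then (e ⟨x, h⟩ : ZFSet) else x, ?_, ?_⟩
  · intro x hx y hy hxy
    simp only [hx, hy, dif_pos] at hxy
    simpa using e.injective (Subtype.ext hxy)
  · intro x hx
    simp only [hx, dif_pos]
    exact (e ⟨x, hx⟩).2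

namespace Model

variable {τ : Vocab.{u}}

theorem ext_of_isIso_id {M N : Model τ} (h : IsIso id M N) : M = N := by
  obtain ⟨⟨hm, hi, hf, hr⟩, hs⟩ := h
  have hc : M.carrier = N.carrier := by
    apply Set.Subset.antisymm hm
    intro x hx
    obtain ⟨y, hy, rfl⟩ := hs hx
    exact hy
  obtain ⟨c, f, r⟩ := M
  obtain ⟨c', f', r'⟩ := N
  obtain rfl : c = c' := hc
  congr
  · funext F x
    exact Subtype.ext (hf F x x fun _ => rfl)
  · funext R x
    exact propext (hr R x x fun _ => rfl)

theorem IsEmbedding.congr {f g : ZFSet.{u} → ZFSet.{u}} {M N : Model τ} (h : IsEmbedding f M N)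
    (hfg : ∀ x ∈ M.carrier, f x = g x) : IsEmbedding g M N where
  mapsTo x hx := hfg x hx ▸ h.mapsTo hx
  injOn x hx y hy hxy := h.injOn hx hy (by rw [hfg x hx, hfg y hy, hxy])
  map_fn F x y hxy := by
    rw [← hfg _ (Subtype.prop _)]
    exact h.map_fn F x y fun i => by rw [hfg _ (Subtype.prop _), hxy]
  map_rel R x y hxy := h.map_rel R x y fun i => by rw [hfg _ (Subtype.prop _), hxy]

theorem IsIso.congr {f g : ZFSet.{u} → ZFSet.{u}} {M N : Model τ} (h : IsIso f M N)
    (hfg : ∀ x ∈ M.carrier, f x = g x) : IsIso g M N where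
  toIsEmbedding := h.toIsEmbedding.congr hfg
  surjOn y hy := by
    obtain ⟨x, hx, rfl⟩ := h.surjOn hy
    exact ⟨x, hx, (hfg x hx).symm⟩

theorem IsIso.refl (M : Model τ) : IsIso id M M where
  mapsTo _ hx := hx
  injOn _ _ _ _ h := h
  map_fn F x y h := by
    have : x = y := funext fun i => Subtype.ext (h i)
    rw [this]; rfl
  map_rel R x y h := by
    have : x = y := funext fun i => Subtype.ext (h i)
    rw [this]
  surjOn x hx := ⟨x, hx, rfl⟩

theorem IsEmbedding.comp {f g : ZFSet.{u} → ZFSet.{u}} {M N P : Model τ} (hg : IsEmbedding g N P)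
    (hf : IsEmbedding f M N) : IsEmbedding (g ∘ f) M P where
  mapsTo := hg.mapsTo.comp hf.mapsTo
  injOn := hg.injOn.comp hf.injOn hf.mapsTo
  map_fn F x z h := by
    have h1 := hf.map_fn F x (fun i => ⟨f (x i), hf.mapsTo (x i).2⟩) fun _ => rfl
    have h2 := hg.map_fn F (fun i => ⟨f (x i), hf.mapsTo (x i).2⟩) z h
    rw [Function.comp_apply, h1, h2]
  map_rel R x z h := (hf.map_rel R x (fun i => ⟨f (x i), hf.mapsTo (x i).2⟩) fun _ => rfl).trans
    (hg.map_rel R (fun i => ⟨f (x i), hf.mapsTo (x i).2⟩) z h)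

theorem IsIso.comp {f g : ZFSet.{u} → ZFSet.{u}} {M N P : Model τ} (hg : IsIso g N P)
    (hf : IsIso f M N) : IsIso (g ∘ f) M P where
  toIsEmbedding := hg.toIsEmbedding.comp hf.toIsEmbedding
  surjOn := hg.surjOn.comp hf.surjOn

theorem IsIso.inv {f g : ZFSet.{u} → ZFSet.{u}} {M N : Model τ} (hf : IsIso f M N)
    (hgf : ∀ x ∈ M.carrier, g (f x) = x) : IsIso g N M := by
  have hm : Set.MapsTo g N.carrier M.carrier := by
    intro y hy
    obtain ⟨x, hx, rfl⟩ := hf.surjOn hy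
    rwa [hgf x hx]
  have hfg : ∀ y ∈ N.carrier, f (g y) = y := by
    intro y hy
    obtain ⟨x, hx, rfl⟩ := hf.surjOn hy
    rw [hgf x hx]
  refine ⟨⟨hm, ?_, ?_, ?_⟩, ?_⟩
  · intro y hy z hz h
    rw [← hfg y hy, h, hfg z hz]
  · intro F y x h
    rw [← hf.map_fn F x y fun i => by rw [← h, hfg _ (y i).2], hgf _ (Subtype.prop _)]
  · intro R y x h
    exact (hf.map_rel R x y fun i => by rw [← h, hfg _ (y i).2]).symm
  · intro x hx
    exact ⟨f x, hf.mapsTo hx, hgf x hx⟩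

theorem IsIso.exists_inv {f : ZFSet.{u} → ZFSet.{u}} {M N : Model τ} (hf : IsIso f M N) :
    ∃ g, IsIso g N M ∧ (∀ x ∈ M.carrier, g (f x) = x) ∧ ∀ y ∈ N.carrier, f (g y) = y := by
  have hgf : ∀ x ∈ M.carrier, Function.invFunOn f M.carrier (f x) = x :=
    fun x hx => hf.injOn.leftInvOn_invFunOn hx
  refine ⟨_, hf.inv hgf, hgf, ?_⟩
  intro y hy
  obtain ⟨x, hx, rfl⟩ := hf.surjOn hy
  rw [hgf x hx]

theorem IsIso.image_eq {f : ZFSet.{u} → ZFSet.{u}} {M N : Model τ} (hf : IsIso f M N) :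
    N.carrier = f '' M.carrier :=
  Set.Subset.antisymm hf.surjOn hf.mapsTo.image_subset

theorem IsIso.card_eq {f : ZFSet.{u} → ZFSet.{u}} {M N : Model τ} (hf : IsIso f M N) :
    N.card = M.card := by
  unfold card
  rw [hf.image_eq]
  exact Cardinal.mk_image_eq_of_injOn _ _ hf.injOn

/-- The structure on an isomorphic copy is determined by the map on points. This turns pointwise
agreement of maps into literal equality of models. -/
theorem IsIso.target_unique {f g : ZFSet.{u} → ZFSet.{u}} {M N N' : Model τ} (h : IsIso f M N)
    (h' : IsIso g M N') (hfg : ∀ x ∈ M.carrier, f x = g x) : N = N' := by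
  obtain ⟨k, hk, -, hfk⟩ := h.exists_inv
  apply ext_of_isIso_id
  refine (h'.comp hk).congr fun y hy => ?_
  have : k y ∈ M.carrier := hk.mapsTo hy
  rw [Function.comp_apply, ← hfg _ this, hfk y hy, id]

/-- The image of a model under an injection. -/
noncomputable def map (f : ZFSet.{u} → ZFSet.{u}) (M : Model τ) (hf : Set.InjOn f M.carrier) :
    Model τ where
  carrier := f '' M.carrier
  fn F y := Equiv.Set.imageOfInjOn f M.carrier hf
    (M.fn F fun i => (Equiv.Set.imageOfInjOn f M.carrier hf).symm (y i))
  rel R y := M.rel R fun i => (Equiv.Set.imageOfInjOn f M.carrier hf).symm (y i)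

theorem isIso_map (f : ZFSet.{u} → ZFSet.{u}) (M : Model τ) (hf : Set.InjOn f M.carrier) :
    IsIso f M (M.map f hf) := by
  have key : ∀ {ι : Type u} (x : ι → M.carrier) (y : ι → (f '' M.carrier : Set ZFSet.{u})),
      (∀ i, f (x i) = y i) →
        (fun i => (Equiv.Set.imageOfInjOn f M.carrier hf).symm (y i)) = x := by
    intro ι x y h
    funext i
    exact (Equiv.symm_apply_eq _).2 (Subtype.ext (h i).symm)
  refine ⟨⟨fun x hx => ⟨x, hx, rfl⟩, hf, ?_, ?_⟩, fun y hy => hy⟩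
  · intro F x y h
    simp only [map, key x y h]
    rfl
  · intro R x y h
    simp only [map, key x y h]

theorem IsSub.subset {M N : Model τ} (h : IsSub M N) : M.carrier ⊆ N.carrier := h.mapsTo

/-- Any model, extending an isomorphic copy of a given model, can be renamed to extend it. -/
theorem exists_rename {f : ZFSet.{u} → ZFSet.{u}} {M P N : Model τ}
    (hM : M.card < Cardinal.univ.{u, u + 1}) (hN : N.card < Cardinal.univ.{u, u + 1})
    (hf : IsIso f M P) :
    ∃ g N', IsIso g N N' ∧ IsIso g P M ∧ ∀ x ∈ M.carrier, g (f x) = x := by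
  obtain ⟨h, hinj, hdisj⟩ := ZFSet.exists_injOn_disjoint M.carrier N.carrier hM hN
  obtain ⟨k, hk, hkf, hfk⟩ := hf.exists_inv
  classical
  -- On the copy `P` undo `f`; send the remaining points of `N` outside `M`, so that the two pieces
  -- do not collide.
  let g : ZFSet.{u} → ZFSet.{u} := fun x => if x ∈ P.carrier then k x else h x
  have hgP : ∀ x ∈ P.carrier, g x = k x := fun x hx => if_pos hx
  have hgn : ∀ x, x ∉ P.carrier → g x = h x := fun x hx => if_neg hx
  have hg : Set.InjOn g N.carrier := by
    intro x hx y hy hxy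
    by_cases h1 : x ∈ P.carrier <;> by_cases h2 : y ∈ P.carrier
    · rw [hgP x h1, hgP y h2] at hxy
      exact hk.injOn h1 h2 hxy
    · rw [hgP x h1, hgn y h2] at hxy
      exact absurd (hxy ▸ hk.mapsTo h1) (hdisj y hy)
    · rw [hgn x h1, hgP y h2] at hxy
      exact absurd (hxy ▸ hk.mapsTo h2) (hdisj x hx)
    · rw [hgn x h1, hgn y h2] at hxy
      exact hinj hx hy hxy
  refine ⟨g, N.map g hg, isIso_map g N hg, hk.congr fun x hx => (hgP x hx).symm, ?_⟩
  intro x hx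
  rw [hgP _ (hf.mapsTo hx), hkf x hx]

end Model

/-! ### Embeddings, amalgams and Löwenheim–Skolem in an ess-AEC. -/

namespace AbstractClass

open Model

variable {τ : Vocab.{u}} {k : AbstractClass τ} {lam mu : Cardinal.{u + 1}}

theorem IsLeEmbedding.injOn {f : ZFSet.{u} → ZFSet.{u}} {M N : Model τ}
    (h : k.IsLeEmbedding f M N) : Set.InjOn f M.carrier :=
  h.choose_spec.1.injOn

theorem IsLeEmbedding.congr {f g : ZFSet.{u} → ZFSet.{u}} {M N : Model τ}
    (h : k.IsLeEmbedding f M N) (hfg : ∀ x ∈ M.carrier, f x = g x) : k.IsLeEmbedding g M N := by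
  obtain ⟨P, hP, hle⟩ := h
  exact ⟨P, hP.congr hfg, hle⟩

namespace IsEssAEC

theorem subset (h : k.IsEssAEC lam mu) {M N : Model τ} (hMN : k.le M N) :
    M.carrier ⊆ N.carrier := (h.isSub hMN).subset

theorem mapsTo (h : k.IsEssAEC lam mu) {f : ZFSet.{u} → ZFSet.{u}} {M N : Model τ}
    (hf : k.IsLeEmbedding f M N) : Set.MapsTo f M.carrier N.carrier := by
  obtain ⟨P, hP, hle⟩ := hf
  exact fun x hx => h.subset hle (hP.mapsTo hx)

theorem card_mono (h : k.IsEssAEC lam mu) {M N : Model τ} (hMN : k.le M N) : M.card ≤ N.card :=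
  Cardinal.mk_le_mk_of_subset (h.subset hMN)

theorem card_lt_univ (h : k.IsEssAEC lam mu) {M : Model τ} (hM : k.K M) :
    M.card < Cardinal.univ.{u, u + 1} := (h.card_lt hM).trans_le h.mu_le

theorem aleph0_le_card (h : k.IsEssAEC lam mu) {M : Model τ} (hM : k.K M) : ℵ₀ ≤ M.card :=
  h.aleph0_le.trans (h.le_card hM)

/-- Two submodels of the same `N` inherit their structure from `N`, so inclusion of universes
already makes one a submodel of the other, and coherence applies. -/
theorem le_of_le_of_subset (h : k.IsEssAEC lam mu) {M P N : Model τ} (hM : k.le M N)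
    (hP : k.le P N) (hs : M.carrier ⊆ P.carrier) : k.le M P := by
  refine h.coherence ?_ hM hP
  have h1 := h.isSub hM
  have h2 := h.isSub hP
  refine ⟨hs, fun _ _ _ _ e => e, ?_, ?_⟩
  · intro F x y e
    have e1 := h1.map_fn F x (fun i => ⟨x i, h1.subset (x i).2⟩) fun _ => rfl
    have e2 := h2.map_fn F y (fun i => ⟨x i, h1.subset (x i).2⟩) fun i => (e i).symm
    exact e1.trans e2.symm
  · intro R x y e
    have e1 := h1.map_rel R x (fun i => ⟨x i, h1.subset (x i).2⟩) fun _ => rfl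
    have e2 := h2.map_rel R y (fun i => ⟨x i, h1.subset (x i).2⟩) fun i => (e i).symm
    exact e1.trans e2.symm

theorem isLeEmbedding_id {M N : Model τ} (hMN : k.le M N) :
    k.IsLeEmbedding id M N := ⟨M, IsIso.refl M, hMN⟩

theorem isLeEmbedding_of_isIso (h : k.IsEssAEC lam mu) {f : ZFSet.{u} → ZFSet.{u}}
    {M N : Model τ} (hM : k.K M) (hf : IsIso f M N) : k.IsLeEmbedding f M N :=
  ⟨N, hf, h.refl (h.iso_mem hf hM)⟩

/-- Isomorphisms restrict to `≤`-submodels. -/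
theorem exists_image (h : k.IsEssAEC lam mu) {f : ZFSet.{u} → ZFSet.{u}} {M N P : Model τ}
    (hPM : k.le P M) (hf : IsIso f M N) : ∃ Q, IsIso f P Q ∧ k.le Q N := by
  have hi : Set.InjOn f P.carrier := hf.injOn.mono (h.subset hPM)
  exact ⟨P.map f hi, isIso_map f P hi, h.iso_le hf (isIso_map f P hi) hPM⟩

theorem restrict (h : k.IsEssAEC lam mu) {f : ZFSet.{u} → ZFSet.{u}} {M N P : Model τ}
    (hf : k.IsLeEmbedding f M N) (hPM : k.le P M) : k.IsLeEmbedding f P N := by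
  obtain ⟨M', hM', hle⟩ := hf
  obtain ⟨Q, hQ, hQM⟩ := h.exists_image hPM hM'
  exact ⟨Q, hQ, h.trans hQM hle⟩

theorem comp (h : k.IsEssAEC lam mu) {f g : ZFSet.{u} → ZFSet.{u}} {M N P : Model τ}
    (hg : k.IsLeEmbedding g N P) (hf : k.IsLeEmbedding f M N) :
    k.IsLeEmbedding (g ∘ f) M P := by
  obtain ⟨M', hM', hle⟩ := hf
  obtain ⟨Q, hQ, hQP⟩ := h.restrict hg hle
  exact ⟨Q, hQ.comp hM', hQP⟩

theorem trans_le (h : k.IsEssAEC lam mu) {f : ZFSet.{u} → ZFSet.{u}} {M N P : Model τ}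
    (hf : k.IsLeEmbedding f M N) (hNP : k.le N P) : k.IsLeEmbedding f M P := by
  obtain ⟨Q, hQ, hQP⟩ := hf
  exact ⟨Q, hQ, h.trans hQP hNP⟩

/-- A `≤`-embedding becomes an inclusion after renaming the target. -/
theorem exists_rename (h : k.IsEssAEC lam mu) {f : ZFSet.{u} → ZFSet.{u}} {M N : Model τ}
    (hM : k.K M) (hf : k.IsLeEmbedding f M N) :
    ∃ g N', IsIso g N N' ∧ k.le M N' ∧ ∀ x ∈ M.carrier, g (f x) = x := by
  obtain ⟨P, hP, hPN⟩ := hf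
  obtain ⟨g, N', hg, hgP, hgf⟩ := Model.exists_rename (h.card_lt_univ hM)
    (h.card_lt_univ (h.mem_right hPN)) hP
  exact ⟨g, N', hg, h.iso_le hg hgP hPN, hgf⟩

/-- Downward Löwenheim–Skolem for a set covering two models. -/
theorem exists_le_card (h : k.IsEssAEC lam mu) {χ : Cardinal.{u + 1}} {N : Model τ}
    (A B : Set ZFSet.{u}) (hN : k.K N) (hA : A ⊆ N.carrier) (hB : B ⊆ N.carrier) (hχ : lam ≤ χ)
    (hAχ : #A ≤ χ) (hBχ : #B ≤ χ) :
    ∃ P, k.le P N ∧ A ⊆ P.carrier ∧ B ⊆ P.carrier ∧ P.card ≤ χ := by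
  obtain ⟨P, hP, hle, hc⟩ := h.lst N (A ∪ B) hN (Set.union_subset hA hB)
  have hχ0 := h.aleph0_le.trans hχ
  refine ⟨P, hle, fun x hx => hP (.inl hx), fun x hx => hP (.inr hx), hc.trans ?_⟩
  refine Cardinal.add_le_of_le hχ0 hχ ((Cardinal.mk_union_le A B).trans ?_)
  exact Cardinal.add_le_of_le hχ0 hAχ hBχ

/-- Amalgamation along a map, with control of the cardinality. -/
theorem exists_amalgam (h : k.IsEssAEC lam mu) (ha : k.Amalgamation)
    {f : ZFSet.{u} → ZFSet.{u}} {M₀ M₁ M₂ : Model τ} (hf : k.IsLeEmbedding f M₀ M₁)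
    (h₂ : k.le M₀ M₂) :
    ∃ N f', k.le M₁ N ∧ k.IsLeEmbedding f' M₂ N ∧ ∀ x ∈ M₀.carrier, f' x = f x := by
  have hM₀ := h.mem_left h₂
  -- Amalgamation speaks of literal extensions: `M₁` is renamed so that `f` becomes an inclusion,
  -- and after amalgamating a second renaming puts `M₁` itself back.
  obtain ⟨g, N₁, hg, hle, hgf⟩ := h.exists_rename hM₀ hf
  obtain ⟨N, g₁, g₂, hg₁, hg₂, hfix₁, hfix₂⟩ := ha M₀ N₁ M₂ hle h₂
  have hM₁ : k.K M₁ := h.mem_right hf.choose_spec.2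
  have hcomp := h.comp hg₁ (h.isLeEmbedding_of_isIso hM₁ hg)
  obtain ⟨r, N', hr, hle', hrc⟩ := h.exists_rename hM₁ hcomp
  have hN : k.K N := h.mem_right hg₁.choose_spec.2
  refine ⟨N', r ∘ g₂, hle', h.comp (h.isLeEmbedding_of_isIso hN hr) hg₂, ?_⟩
  intro x hx
  have hfx : f x ∈ M₁.carrier := h.mapsTo hf hx
  have := hrc _ hfx
  rw [Function.comp_apply, hgf x hx, hfix₁ x hx] at this
  rw [Function.comp_apply, hfix₂ x hx, this]

/-- Shrinking the common target of an inclusion and of a `≤`-embedding. -/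
theorem exists_shrink (h : k.IsEssAEC lam mu) {χ : Cardinal.{u + 1}}
    {f : ZFSet.{u} → ZFSet.{u}} {M₁ M₂ N : Model τ} (h₁ : k.le M₁ N)
    (h₂ : k.IsLeEmbedding f M₂ N) (hc₁ : M₁.card = χ) (hc₂ : M₂.card ≤ χ) :
    ∃ P, k.le P N ∧ k.le M₁ P ∧ k.IsLeEmbedding f M₂ P ∧ P.card = χ := by
  obtain ⟨Q, hQ, hQN⟩ := h₂
  obtain ⟨P, hPN, hA, hB, hc⟩ := h.exists_le_card M₁.carrier Q.carrier (h.mem_right h₁)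
    (h.subset h₁) (h.subset hQN) (hc₁ ▸ h.le_card (h.mem_left h₁)) hc₁.le
    (hQ.card_eq.trans_le hc₂)
  have hM₁P := h.le_of_le_of_subset h₁ hPN hA
  exact ⟨P, hPN, hM₁P, ⟨Q, hQ, h.le_of_le_of_subset hQN hPN hB⟩,
    hc.antisymm (hc₁ ▸ h.card_mono hM₁P)⟩

end IsEssAEC

end AbstractClass

-- Transfinite constructions and cardinal bounds.

universe v w

/-- Transfinite dependent choice. -/
theorem Ordinal.exists_history {X : Type w} [Nonempty X]
    (P : ∀ i : Ordinal.{v}, (Set.Iio i → X) → X → Prop) (δ : Ordinal.{v})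
    (h : ∀ i < δ, ∀ s : Ordinal.{v} → X, (∀ j < i, P j (fun l => s l) (s j)) →
      ∃ x, P i (fun l => s l) x) :
    ∃ s : Ordinal.{v} → X, ∀ i < δ, P i (fun l => s l) (s i) := by
  classical
  let F : ∀ i : Ordinal.{v}, (∀ j, j < i → X) → X := fun i s =>
    -- The default value is never taken for `i < δ`.
    if hx : ∃ x, P i (fun l => s l l.2) x then hx.choose else Classical.arbitrary X
  let s : Ordinal.{v} → X := WellFounded.fix Ordinal.lt_wf F
  have hs : ∀ i, s i = F i fun j _ => s j := fun i => WellFounded.fix_eq Ordinal.lt_wf F i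
  refine ⟨s, fun i => ?_⟩
  induction i using WellFoundedLT.induction with
  | ind i ih =>
    intro hi
    have hx := h i hi s fun j hj => ih j hj (hj.trans hi)
    rw [hs i]
    simp only [F]
    rw [dif_pos hx]
    exact hx.choose_spec

/-- A set of cardinality at most `c` can be enumerated along `c.ord`. -/
theorem Cardinal.exists_enum {α : Type v} [Nonempty α] (B : Set α) (c : Cardinal.{v})
    (hB : #B ≤ c) : ∃ e : Ordinal.{v} → α, ∀ p ∈ B, ∃ i < c.ord, e i = p := by
  have h1 : #B ≤ #c.ord.ToType := by rwa [Cardinal.mk_toType, Cardinal.card_ord]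
  obtain ⟨φ⟩ := (Cardinal.le_def _ _).1 h1
  let ψ : B → Ordinal.{v} := fun p => (Ordinal.ToType.toOrd (φ p)).1
  have hψ : Function.Injective ψ := fun p q hpq =>
    φ.injective (Ordinal.ToType.mk.symm.injective (Subtype.ext hpq))
  refine ⟨Function.extend ψ Subtype.val fun _ => Classical.arbitrary α, fun p hp => ?_⟩
  exact ⟨ψ ⟨p, hp⟩, (Ordinal.ToType.toOrd (φ ⟨p, hp⟩)).2, hψ.extend_apply _ _ _⟩

theorem Cardinal.mk_biUnion_Iio_le {α : Type v} (δ : Ordinal.{v}) (A : Ordinal.{v} → Set α)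
    (c : Cardinal.{v}) (hc : ∀ i < δ, #(A i) ≤ c) :
    #(⋃ i ∈ Set.Iio δ, A i : Set α) ≤ δ.card * c := by
  have h := Cardinal.mk_biUnion_le_lift A (Set.Iio δ)
  rw [Cardinal.mk_Iio_ordinal, Cardinal.lift_lift] at h
  rw [← Cardinal.lift_le.{v + 1}, Cardinal.lift_mul]
  refine h.trans (mul_le_mul' le_rfl ?_)
  exact ciSup_le' fun i => Cardinal.lift_le.2 (hc i i.2)

namespace AbstractClass

open Model

variable {τ : Vocab.{u}} {k : AbstractClass τ} {lam mu : Cardinal.{u + 1}}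

namespace IsEssAEC

/-- Increasing continuous chains can be built by iterating a cardinality preserving extension
step. -/
theorem exists_continuous_chain (h : k.IsEssAEC lam mu) {M₀ : Model τ} (hM₀ : k.K M₀)
    {δ : Ordinal.{u + 1}} (hδ : δ ≤ mu.ord) (S : Ordinal.{u + 1} → Model τ → Model τ → Prop)
    (hS : ∀ i < δ, ∀ M, k.le M₀ M → ∃ M', k.le M M' ∧ M'.card = M.card ∧ S i M M') :
    ∃ M : Ordinal.{u + 1} → Model τ, M 0 = M₀ ∧ k.IsContinuous δ M ∧
      (∀ i < δ, (M i).card ≤ M₀.card + i.card) ∧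
      ∀ i, Order.succ i < δ → S i (M i) (M (Order.succ i)) := by
  let P : ∀ i : Ordinal.{u + 1}, (Set.Iio i → Model τ) → Model τ → Prop := fun i s x =>
    k.le M₀ x ∧ x.card ≤ M₀.card + i.card ∧ (i = 0 → x = M₀) ∧ (∀ j, k.le (s j) x) ∧
      (∀ j : Set.Iio i, Order.succ j.1 = i → S j (s j) x) ∧
      (Order.IsSuccLimit i → x.carrier = ⋃ j, (s j).carrier)
  have : Nonempty (Model τ) := ⟨M₀⟩
  obtain ⟨M, hM⟩ := Ordinal.exists_history P δ (by
    intro i hi s hs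
    have hi' := hi.trans_le hδ
    rcases Ordinal.zero_or_succ_or_isSuccLimit i with rfl | ⟨j, rfl⟩ | hlim
    · refine ⟨M₀, h.refl hM₀, by simp, fun _ => rfl, fun j => ?_, fun j => ?_, fun hl => ?_⟩
      · exact absurd j.2 (by simp)
      · exact absurd j.2 (by simp)
      · exact absurd hl (by simp)
    · have hj : j < Order.succ j := Order.lt_succ j
      obtain ⟨h1, h2, -, h4, -, -⟩ := hs j hj
      obtain ⟨M', hle, hc, hSM⟩ := hS j (hj.trans hi) (s j) h1
      refine ⟨M', h.trans h1 hle, ?_, fun h0 => ?_, fun l => ?_, fun l hl => ?_, fun hl => ?_⟩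
      · rw [hc]
        exact h2.trans (add_le_add le_rfl (Ordinal.card_le_card hj.le))
      · exact absurd h0 (Order.succ_ne_bot j)
      · rcases (Order.lt_succ_iff.1 (Set.mem_Iio.1 l.2)).lt_or_eq with hlj | hlj
        · exact h.trans (h4 ⟨l, hlj⟩) hle
        · simpa only [hlj] using hle
      · have : l.1 = j := Order.succ_injective hl
        simpa only [this] using hSM
      · exact absurd hl (Order.not_isSuccLimit_succ j)
    · have hinc : k.IsIncreasing i s := by
        refine ⟨fun j hj => h.mem_right (hs j hj).1, fun j l hjl hl => ?_⟩
        rcases hjl.lt_or_eq with hjl | rfl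
        · exact (hs l hl).2.2.2.1 ⟨j, hjl⟩
        · exact h.refl (h.mem_right (hs j hl).1)
      have hinf := h.aleph0_le_card hM₀
      -- Successor steps preserve cardinality, so the union has size at most `‖M₀‖ + |i|`, which is
      -- below `mu` as `i < mu.ord`; the union axiom then applies.
      have hcard : #(⋃ j ∈ Set.Iio i, (s j).carrier : Set ZFSet.{u}) ≤ M₀.card + i.card := by
        refine (Cardinal.mk_biUnion_Iio_le i _ (M₀.card + i.card) fun j hj => ?_).trans ?_
        · exact (hs j hj).2.1.trans (add_le_add le_rfl (Ordinal.card_le_card hj.le))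
        · exact Cardinal.mul_le_of_le (hinf.trans (self_le_add_right _ _))
            (self_le_add_left _ _) le_rfl
      have hlt : M₀.card + i.card < mu :=
        Cardinal.add_lt_of_lt (hinf.trans (h.card_lt hM₀).le) (h.card_lt hM₀)
          (Cardinal.lt_ord.1 hi')
      obtain ⟨N, ⟨hN, hU, hle⟩, -⟩ := h.union i s hlim hinc (hcard.trans_lt hlt)
      have h0 : (0 : Ordinal.{u + 1}) < i := hlim.bot_lt
      refine ⟨N, ?_, ?_, fun h0' => absurd h0' h0.ne', fun j => hle j j.2, fun j hj => ?_,
        fun _ => ?_⟩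
      · exact h.trans (hs 0 h0).1 (hle 0 h0)
      · unfold card
        rw [hU]
        exact hcard
      · exact absurd (hj ▸ hlim) (Order.not_isSuccLimit_succ _)
      · rw [hU, Set.biUnion_eq_iUnion])
  -- For `δ = 0` the recursion says nothing about `M 0`, so the constant sequence is used.
  by_cases hδ0 : δ = 0
  · subst hδ0
    exact ⟨fun _ => M₀, rfl, ⟨⟨fun i hi => absurd hi (by simp), fun i j _ hj => absurd hj (by simp)⟩,
      fun j hj => absurd hj (by simp)⟩, fun j hj => absurd hj (by simp),
      fun j hj => absurd hj (by simp)⟩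
  refine ⟨M, (hM 0 (pos_iff_ne_zero.2 hδ0)).2.2.1 rfl, ⟨⟨?_, ?_⟩, ?_⟩, ?_, ?_⟩
  · exact fun j hj => h.mem_right (hM j hj).1
  · intro j l hjl hl
    rcases hjl.lt_or_eq with hjl | rfl
    · exact (hM l hl).2.2.2.1 ⟨j, hjl⟩
    · exact h.refl (h.mem_right (hM j hl).1)
  · intro j hj hl
    have := (hM j hj).2.2.2.2.2 hl
    rw [IsUnionBelow, this, Set.biUnion_eq_iUnion]
  · exact fun i hi => (hM i hi).2.1
  · intro i hi
    exact (hM _ hi).2.2.2.2.1 ⟨i, Order.lt_succ i⟩ rfl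

end IsEssAEC

end AbstractClass

/-! ### Orbital types under amalgamation. -/

namespace AbstractClass

open Model

variable {τ : Vocab.{u}} {k : AbstractClass τ} {lam mu : Cardinal.{u + 1}}

namespace IsEssAEC

theorem atEquiv_refl (h : k.IsEssAEC lam mu) {M N : Model τ} {a : ZFSet.{u}} (hMN : k.le M N)
    (ha : a ∈ N.carrier) : k.AtEquiv M (N, a) (N, a) :=
  ⟨hMN, ha, hMN, ha, N, id, id, isLeEmbedding_id (h.refl (h.mem_right hMN)),
    isLeEmbedding_id (h.refl (h.mem_right hMN)), fun _ _ => rfl, fun _ _ => rfl, rfl⟩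

theorem mem_ortp_self (h : k.IsEssAEC lam mu) {M N : Model τ} {a : ZFSet.{u}} (hMN : k.le M N)
    (ha : a ∈ N.carrier) : (N, a) ∈ k.ortp a M N :=
  .single (h.atEquiv_refl hMN ha)

/-- Under amalgamation, atomic equivalence is transitive. -/
theorem atEquiv_trans (h : k.IsEssAEC lam mu) (ha : k.Amalgamation) {M : Model τ}
    {x y z : Model τ × ZFSet.{u}} (hxy : k.AtEquiv M x y) (hyz : k.AtEquiv M y z) :
    k.AtEquiv M x z := by
  obtain ⟨hx, hxm, hy, hym, R, f, g, hf, hg, hfM, hgM, hfg⟩ := hxy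
  obtain ⟨-, -, hz, hzm, S, f', g', hf', hg', hfM', hgM', hfg'⟩ := hyz
  -- Both witnesses contain copies of the middle model `y.1`; rename the first to extend `y.1` and
  -- amalgamate the two over it.
  obtain ⟨r, R', hr, hle, hrg⟩ := h.exists_rename (h.mem_right hy) hg
  obtain ⟨T, t, hST, ht, htf⟩ := h.exists_amalgam ha hf' hle
  have hR : k.K R := h.mem_right hf.choose_spec.2
  refine ⟨hx, hxm, hz, hzm, T, t ∘ r ∘ f, g',
    h.comp ht (h.comp (h.isLeEmbedding_of_isIso hR hr) hf), h.trans_le hg' hST, ?_, hgM', ?_⟩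
  · intro a haM
    have haN := h.subset hy haM
    have h1 := hrg a haN
    rw [hgM a haM] at h1
    rw [Function.comp_apply, Function.comp_apply, hfM a haM, h1, htf a haN, hfM' a haM]
  · rw [Function.comp_apply, Function.comp_apply, hfg, hrg _ hym, htf _ hym, hfg']

theorem atEquiv_of_ortp_eq (h : k.IsEssAEC lam mu) (ha : k.Amalgamation) {M N N' : Model τ}
    {a a' : ZFSet.{u}} (hN' : k.le M N') (ha' : a' ∈ N'.carrier)
    (heq : k.ortp a M N = k.ortp a' M N') : k.AtEquiv M (N, a) (N', a') := by
  have hmem : (N', a') ∈ k.ortp a M N := heq ▸ h.mem_ortp_self hN' ha'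
  have key : ∀ z, Relation.TransGen (k.AtEquiv M) (N, a) z → k.AtEquiv M (N, a) z := by
    intro z hz
    induction hz with
    | single h1 => exact h1
    | tail _ h2 ih => exact h.atEquiv_trans ha ih h2
  exact key _ hmem

/-- Equal orbital types can be identified by an amalgam. -/
theorem exists_amalgam_of_ortp_eq (h : k.IsEssAEC lam mu) (ha : k.Amalgamation)
    {M N N' : Model τ} {a a' : ZFSet.{u}} (hN' : k.le M N')
    (ha' : a' ∈ N'.carrier) (heq : k.ortp a M N = k.ortp a' M N') :
    ∃ P f, k.le N P ∧ k.IsLeEmbedding f N' P ∧ FixesOn f M ∧ f a' = a := by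
  obtain ⟨hN, haN, -, -, R, f, g, hf, hg, hfM, hgM, hfg⟩ := h.atEquiv_of_ortp_eq ha hN' ha' heq
  obtain ⟨r, R', hr, hle, hrf⟩ := h.exists_rename (h.mem_right hN) hf
  have hR : k.K R := h.mem_right hf.choose_spec.2
  refine ⟨R', r ∘ g, hle, h.comp (h.isLeEmbedding_of_isIso hR hr) hg, ?_, ?_⟩
  · intro x hx
    have h1 := hrf x (h.subset hN hx)
    rw [hfM x hx] at h1
    rw [Function.comp_apply, hgM x hx, h1]
  · rw [Function.comp_apply, ← hfg, hrf a haN]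

/-- The embedding itself witnesses atomic equivalence in both directions. In particular, types do
not change when the ambient model grows. -/
theorem ortp_eq_of_isLeEmbedding (h : k.IsEssAEC lam mu) {M N P : Model τ}
    {f : ZFSet.{u} → ZFSet.{u}} {a : ZFSet.{u}} (hMN : k.le M N)
    (haN : a ∈ N.carrier) (hf : k.IsLeEmbedding f N P) (hfM : FixesOn f M) :
    k.ortp (f a) M P = k.ortp a M N := by
  have hP : k.K P := h.mem_right hf.choose_spec.2
  have hMP : k.le M P := by
    obtain ⟨Q, hQ, hQP⟩ := h.restrict hf hMN
    have := (IsIso.refl M).target_unique hQ fun x hx => (hfM x hx).symm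
    rwa [this]
  have hfa := h.mapsTo hf haN
  have hid := isLeEmbedding_id (h.refl hP)
  have h1 : k.AtEquiv M (P, f a) (N, a) :=
    ⟨hMP, hfa, hMN, haN, P, id, f, hid, hf, fun _ _ => rfl, hfM, rfl⟩
  have h2 : k.AtEquiv M (N, a) (P, f a) :=
    ⟨hMN, haN, hMP, hfa, P, f, id, hf, hid, hfM, fun _ _ => rfl, rfl⟩
  ext y
  exact ⟨fun hy => .head h2 hy, fun hy => .head h1 hy⟩

/-- Any small enough set of types over `M` is realized in some extension of `M` of the same
cardinality. -/
theorem exists_realizing (h : k.IsEssAEC lam mu) (ha : k.Amalgamation) {M : Model τ}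
    (hM : k.K M) (B : Set (Set (Model τ × ZFSet.{u}))) (hB : B ⊆ k.types M) (hBM : #B ≤ M.card) :
    ∃ M', k.le M M' ∧ M'.card = M.card ∧ ∀ p ∈ B, ∃ b ∈ M'.carrier, k.ortp b M M' = p := by
  have hinf := h.aleph0_le_card hM
  have hlim := Cardinal.isSuccLimit_ord hinf
  obtain ⟨e, he⟩ := Cardinal.exists_enum B M.card hBM
  let δ := M.card.ord
  -- The chain has length `δ + 1`, so that its last model `s δ` is part of it.
  have hδ : Order.succ δ ≤ mu.ord := by
    rw [Order.succ_le_iff]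
    exact Cardinal.ord_lt_ord.2 (h.card_lt hM)
  obtain ⟨s, hs0, ⟨⟨hsK, hsle⟩, -⟩, hsc, hsS⟩ := h.exists_continuous_chain hM hδ
    -- Step `i` realizes the one type `e i`; the guard is needed because the enumeration may take
    -- values outside `B`.
    (fun i N N' => e i ∈ B → ∃ b ∈ N'.carrier, k.ortp b M N' = e i) (by
      intro i hi N hMN
      by_cases hei : e i ∈ B
      · obtain ⟨R, b, hMR, hbR, hbe⟩ := hB hei
        -- The given realization may live in a large model; cut it down to size `‖M‖` before
        -- amalgamating with `N`.
        obtain ⟨R', hR'R, hMs, hbs, hR'c⟩ := h.exists_le_card M.carrier {b} (h.mem_right hMR)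
          (h.subset hMR) (by simpa using hbR) (h.le_card hM) le_rfl
          (by simpa using Cardinal.one_le_aleph0.trans hinf)
        have hMR' := h.le_of_le_of_subset hMR hR'R hMs
        have hb : b ∈ R'.carrier := by simpa using hbs
        obtain ⟨T, f, hNT, hf, hfM⟩ := h.exists_amalgam ha (isLeEmbedding_id hMN) hMR'
        obtain ⟨N', -, hNN', hf', hc⟩ := h.exists_shrink hNT hf rfl
          (hR'c.trans (h.card_mono hMN))
        refine ⟨N', hNN', hc, fun _ => ⟨f b, h.mapsTo hf' hb, ?_⟩⟩
        rw [h.ortp_eq_of_isLeEmbedding hMR' hb hf' hfM, hbe]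
        exact (h.ortp_eq_of_isLeEmbedding hMR' hb (isLeEmbedding_id hR'R) fun _ _ => rfl).symm
      · exact ⟨N, h.refl (h.mem_right hMN), rfl, fun h' => absurd h' hei⟩)
  have hlt : ∀ i < δ, Order.succ i < Order.succ δ := fun i hi => Order.succ_lt_succ hi
  have hMδ : k.le M (s δ) := hs0 ▸ hsle 0 δ zero_le (Order.lt_succ δ)
  refine ⟨s δ, hMδ, ?_, ?_⟩
  · refine le_antisymm ((hsc δ (Order.lt_succ δ)).trans ?_) (h.card_mono hMδ)
    rw [Cardinal.card_ord]
    exact Cardinal.add_le_of_le hinf le_rfl le_rfl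
  · intro p hp
    obtain ⟨i, hi, rfl⟩ := he p hp
    obtain ⟨b, hb, hbe⟩ := hsS i (hlt i hi) hp
    have hsi : Order.succ i < δ := hlim.succ_lt hi
    have hle := hsle _ δ hsi.le (Order.lt_succ δ)
    have hMs : k.le M (s (Order.succ i)) := hs0 ▸ hsle 0 _ zero_le (hsi.trans (Order.lt_succ δ))
    refine ⟨b, h.subset hle hb, ?_⟩
    rw [← hbe]
    exact h.ortp_eq_of_isLeEmbedding hMs hb (isLeEmbedding_id hle) fun _ _ => rfl

end IsEssAEC

end AbstractClass

/-! ### Universal extensions. -/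

open Model AbstractClass

variable {τ : Vocab.{u}} {lam mu : Cardinal.{u + 1}}

/-- The union of a coherent system of `≤`-embeddings is a `≤`-embedding. -/
theorem AbstractClass.IsEssAEC.exists_limit_embedding {k : AbstractClass τ}
    (h : k.IsEssAEC lam mu) {δ : Ordinal.{u + 1}} (hlim : Order.IsSuccLimit δ)
    {M N : Ordinal.{u + 1} → Model τ} {f : Ordinal.{u + 1} → ZFSet.{u} → ZFSet.{u}}
    {M' N' : Model τ} (hM : ∀ i j, i ≤ j → j < δ → k.le (M i) (M j))
    (hM' : ∀ i < δ, k.le (M i) M') (hU : IsUnionBelow δ M M') (hN' : ∀ i < δ, k.le (N i) N')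
    (hf : ∀ i < δ, k.IsLeEmbedding (f i) (M i) (N i))
    (hcoh : ∀ i j, i ≤ j → j < δ → ∀ x ∈ (M i).carrier, f j x = f i x) :
    ∃ g, k.IsLeEmbedding g M' N' ∧ ∀ i < δ, ∀ x ∈ (M i).carrier, g x = f i x := by
  classical
  have : Nonempty (Model τ) := ⟨M'⟩
  have hmem : ∀ {x}, x ∈ M'.carrier → ∃ i < δ, x ∈ (M i).carrier := by
    intro x hx
    rw [hU] at hx
    simpa using hx
  let g : ZFSet.{u} → ZFSet.{u} := fun x =>
    if hx : ∃ i < δ, x ∈ (M i).carrier then f hx.choose x else x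
  have hg : ∀ i < δ, ∀ x ∈ (M i).carrier, g x = f i x := by
    intro i hi x hx
    have hex : ∃ i < δ, x ∈ (M i).carrier := ⟨i, hi, hx⟩
    have hgx : g x = f hex.choose x := dif_pos hex
    rw [hgx]
    obtain ⟨h1, h2⟩ := hex.choose_spec
    rcases le_total i hex.choose with hle | hle
    · exact hcoh _ _ hle h1 x hx
    · exact (hcoh _ _ hle hi x h2).symm
  have hinj : Set.InjOn g M'.carrier := by
    intro x hx y hy hxy
    obtain ⟨i, hi, hxi⟩ := hmem hx
    obtain ⟨j, hj, hyj⟩ := hmem hy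
    have hm : max i j < δ := max_lt hi hj
    have hx' := h.subset (hM _ _ (le_max_left i j) hm) hxi
    have hy' := h.subset (hM _ _ (le_max_right i j) hm) hyj
    rw [hg _ hm x hx', hg _ hm y hy'] at hxy
    exact (hf _ hm).injOn hx' hy' hxy
  have hMg := isIso_map g M' hinj
  choose! Q hQ hQN using hf
  have hQg : ∀ i < δ, IsIso g (M i) (Q i) := fun i hi =>
    (hQ i hi).congr fun x hx => (hg i hi x hx).symm
  have hQle : ∀ i < δ, k.le (Q i) (M'.map g hinj) := fun i hi =>
    h.iso_le hMg (hQg i hi) (hM' i hi)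
  refine ⟨g, ⟨M'.map g hinj, hMg, ?_⟩, hg⟩
  have h0 : (0 : Ordinal.{u + 1}) < δ := hlim.bot_lt
  -- The image of `M'` is the union of the images `Q i ≤ N'`, so smoothness gives that it is `≤ N'`.
  refine h.smooth δ Q hlim ⟨fun i hi => h.mem_left (hQN i hi), fun i j hij hj => ?_⟩ _ _
    (h.iso_mem hMg (h.mem_right (hM' 0 h0))) ?_ hQle fun i hi => h.trans (hQN i hi) (hN' i hi)
  · have hi := hij.trans_lt hj
    exact h.iso_le (hQg j hj) (hQg i hi) (hM i j hij hj)
  · rw [IsUnionBelow, hMg.image_eq, hU, Set.image_iUnion₂]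
    exact Set.iUnion₂_congr fun i hi => (hQg i hi).image_eq.symm

namespace GoodEssFrame

variable (s : GoodEssFrame τ lam mu)

/-- Extend an embedding to a model realizing all basic types, while covering a given
point whose type over the range is basic. -/
theorem exists_extend {f : ZFSet.{u} → ZFSet.{u}} {M₀ P M₁ M₂ : Model τ} (hf : IsIso f M₀ P)
    (hP : s.cls.le P M₁) (h₂ : s.cls.le M₀ M₂) (hc : M₂.card = M₁.card)
    (hreal : ∀ p ∈ s.bs M₀, ∃ b ∈ M₂.carrier, s.cls.ortp b M₀ M₂ = p) (a : ZFSet.{u}) :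
    ∃ N f', s.cls.le M₁ N ∧ N.card = M₁.card ∧ s.cls.IsLeEmbedding f' M₂ N ∧
      (∀ x ∈ M₀.carrier, f' x = f x) ∧
      (a ∈ M₁.carrier → s.cls.ortp a P M₁ ∈ s.bs P → a ∈ f' '' M₂.carrier) := by
  have h := s.cls_ess
  have hfl : s.cls.IsLeEmbedding f M₀ M₁ := ⟨P, hf, hP⟩
  have hM₁ := h.mem_right hP
  by_cases hab : a ∈ M₁.carrier ∧ s.cls.ortp a P M₁ ∈ s.bs P
  · obtain ⟨haM, hbs⟩ := hab
    obtain ⟨g, N₁, hg, hle, hgf⟩ := h.exists_rename (h.mem_left h₂) hfl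
    -- Pull the type of `a` back along `f` to a basic type over `M₀`. It is realized by some `b` in
    -- `M₂`, and the amalgam is chosen to identify `b` with `a`.
    have hbs' := s.bs_iso g P M₁ M₀ N₁ a hP hle haM hg (hf.inv hgf) hbs
    obtain ⟨b, hb, hbeq⟩ := hreal _ hbs'
    obtain ⟨T, t, hNT, ht, htfix, htb⟩ :=
      h.exists_amalgam_of_ortp_eq s.amalgamation h₂ hb hbeq.symm
    obtain ⟨r, T', hr, hle', hrg⟩ := h.exists_rename hM₁
      (h.trans_le (h.isLeEmbedding_of_isIso hM₁ hg) hNT)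
    have hT := h.mem_right hNT
    obtain ⟨N, -, hMN, hN, hcN⟩ := h.exists_shrink hle'
      (h.comp (h.isLeEmbedding_of_isIso hT hr) ht) rfl hc.le
    refine ⟨N, r ∘ t, hMN, hcN, hN, ?_, fun _ _ => ⟨b, hb, ?_⟩⟩
    · intro x hx
      have := hrg (f x) (h.mapsTo hfl hx)
      rw [hgf x hx] at this
      rw [Function.comp_apply, htfix x hx, this]
    · rw [Function.comp_apply, htb, hrg a haM]
  · obtain ⟨T, f', hT, hf', hff⟩ := h.exists_amalgam s.amalgamation hfl h₂
    obtain ⟨N, -, hMN, hN, hcN⟩ := h.exists_shrink hT hf' rfl hc.le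
    exact ⟨N, f', hMN, hcN, hN, hff, fun h1 h2 => absurd ⟨h1, h2⟩ hab⟩

/-- A long enough chain, in which every model realizes the basic types over the previous ones,
absorbs all extensions of its first model. -/
theorem isUniversalOver_of_chain {χ : Cardinal.{u + 1}} (hχ : ℵ₀ ≤ χ)
    {M : Ordinal.{u + 1} → Model τ} (hM : s.cls.IsContinuous (Order.succ (χ.ord * Ordinal.omega0)) M)
    (hc : ∀ i < Order.succ (χ.ord * Ordinal.omega0), (M i).card = χ)
    (hreal : ∀ i < χ.ord * Ordinal.omega0, ∀ p ∈ s.bs (M i), ∃ b ∈ (M (Order.succ i)).carrier,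
      s.cls.ortp b (M i) (M (Order.succ i)) = p) :
    s.cls.IsUniversalOver (M 0) (M (χ.ord * Ordinal.omega0)) := by
  have h := s.cls_ess
  obtain ⟨⟨hMK, hMle⟩, hMU⟩ := hM
  have hχ0 : χ.ord ≠ 0 := by
    rw [Ne, Cardinal.ord_eq_zero]
    exact (Cardinal.aleph0_pos.trans_le hχ).ne'
  have hδlim : Order.IsSuccLimit (χ.ord * Ordinal.omega0) :=
    Ordinal.isSuccLimit_mul_right (pos_iff_ne_zero.2 hχ0) Ordinal.isSuccLimit_omega0
  have hmulω := fun a => Ordinal.lt_mul_iff_of_isSuccLimit (a := a) (b := χ.ord)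
    Ordinal.isSuccLimit_omega0
  generalize hδ : χ.ord * Ordinal.omega0 = δ at *
  have hδδ : δ < Order.succ δ := Order.lt_succ δ
  have h0δ : (0 : Ordinal.{u + 1}) < δ := hδlim.bot_lt
  have h0 : (0 : Ordinal.{u + 1}) < Order.succ δ := h0δ.trans hδδ
  refine ⟨hMle 0 δ zero_le hδδ, by rw [hc _ hδδ, hc _ h0], fun N hN hNc => ?_⟩
  rw [hc _ h0] at hNc
  have henum : ∀ R : Model τ, ∃ e : Ordinal.{u + 1} → ZFSet.{u},
      R.card = χ → ∀ a ∈ R.carrier, ∃ i < χ.ord, e i = a := by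
    intro R
    by_cases hR : R.card = χ
    · obtain ⟨e, he⟩ := Cardinal.exists_enum R.carrier χ hR.le
      exact ⟨e, fun _ => he⟩
    · exact ⟨fun _ => ∅, fun h' => absurd h' hR⟩
  choose e he using henum
  -- The last clause is the bookkeeping. Write `j = χ.ord * n + r` with `r < χ.ord`: then `l` is the
  -- start of the `n`-th block, and the point treated at step `j` is the `r`-th one in the
  -- enumeration of the model at stage `l`.
  let P : ∀ i : Ordinal.{u + 1}, (Set.Iio i → Model τ × (ZFSet.{u} → ZFSet.{u})) →
      Model τ × (ZFSet.{u} → ZFSet.{u}) → Prop := fun i t x =>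
    x.1.card = χ ∧ s.cls.IsLeEmbedding x.2 (M i) x.1 ∧ (i = 0 → x = (N, id)) ∧
      (∀ j : Set.Iio i, s.cls.le (t j).1 x.1 ∧ ∀ y ∈ (M j).carrier, x.2 y = (t j).2 y) ∧
      (Order.IsSuccLimit i → x.1.carrier = ⋃ j, (t j).1.carrier) ∧
      (∀ j l : Set.Iio i, Order.succ j.1 = i → l.1 = χ.ord * (j.1 / χ.ord) →
        ∀ Q, IsIso (t j).2 (M j) Q → e (t l).1 (j.1 % χ.ord) ∈ (t j).1.carrier →
          s.cls.ortp (e (t l).1 (j.1 % χ.ord)) Q (t j).1 ∈ s.bs Q →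
          e (t l).1 (j.1 % χ.ord) ∈ x.2 '' (M i).carrier)
  have : Nonempty (Model τ × (ZFSet.{u} → ZFSet.{u})) := ⟨(N, id)⟩
  obtain ⟨t, ht⟩ := Ordinal.exists_history P (Order.succ δ) (by
    intro i hi t ht
    rcases Ordinal.zero_or_succ_or_isSuccLimit i with rfl | ⟨j, rfl⟩ | hlim
    · refine ⟨(N, id), hNc, IsEssAEC.isLeEmbedding_id hN, fun _ => rfl, fun j => ?_, fun hl => ?_,
        fun j => ?_⟩
      · exact absurd j.2 (by simp)
      · exact absurd hl (by simp)
      · exact absurd j.2 (by simp)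
    · have hj : j < Order.succ j := Order.lt_succ j
      have hjδ : j < δ := Order.succ_lt_succ_iff.1 hi
      obtain ⟨h1, ⟨Q, hQ, hQle⟩, -, h4, -, -⟩ := ht j hj
      obtain ⟨N', f', hle, hNc', hf', hff, hab⟩ := s.exists_extend hQ hQle
        (hMle _ _ hj.le hi) (by rw [hc _ hi, h1]) (hreal j hjδ)
        (e (t (χ.ord * (j / χ.ord))).1 (j % χ.ord))
      refine ⟨(N', f'), hNc'.trans h1, hf', fun h0' => ?_, fun l => ?_, fun hl => ?_, ?_⟩
      · exact absurd h0' (Order.succ_ne_bot j)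
      · rcases (Order.lt_succ_iff.1 (Set.mem_Iio.1 l.2)).lt_or_eq with hlj | hlj
        · obtain ⟨h5, h6⟩ := h4 ⟨l, hlj⟩
          refine ⟨h.trans h5 hle, fun y hy => ?_⟩
          have hyj := h.subset (hMle _ _ hlj.le (hj.trans hi)) hy
          exact (hff y hyj).trans (h6 y hy)
        · simp only [hlj]
          exact ⟨hle, hff⟩
      · exact absurd hl (Order.not_isSuccLimit_succ j)
      · rintro ⟨j', hj'⟩ ⟨l, hl'⟩ hjj hl R hR hmem hbs
        obtain rfl : j' = j := Order.succ_injective hjj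
        simp only at hl
        subst hl
        obtain rfl := hR.target_unique hQ fun _ _ => rfl
        exact hab hmem hbs
    · have hiδ : i ≤ δ := Order.lt_succ_iff.1 hi
      have hinc : s.cls.IsIncreasing i fun j => (t j).1 := by
        refine ⟨fun j hj => h.mem_right (ht j hj).2.1.choose_spec.2, fun j l hjl hl => ?_⟩
        rcases hjl.lt_or_eq with hjl | rfl
        · exact ((ht l hl).2.2.2.1 ⟨j, hjl⟩).1
        · exact h.refl (h.mem_right (ht j hl).2.1.choose_spec.2)
      have hicard : i.card ≤ χ := by
        refine (Ordinal.card_le_card hiδ).trans ?_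
        rw [← hδ, Ordinal.card_mul, Cardinal.card_ord, Ordinal.card_omega0]
        exact Cardinal.mul_le_of_le hχ le_rfl hχ
      have hcard : #(⋃ j ∈ Set.Iio i, (t j).1.carrier : Set ZFSet.{u}) ≤ χ :=
        (Cardinal.mk_biUnion_Iio_le i _ χ fun j hj => (ht j hj).1.le).trans
          (Cardinal.mul_le_of_le hχ hicard le_rfl)
      obtain ⟨N', ⟨-, hU, hle⟩, -⟩ := h.union i _ hlim hinc
        (hcard.trans_lt (hNc ▸ h.card_lt (h.mem_right hN)))
      have h0i : (0 : Ordinal.{u + 1}) < i := hlim.bot_lt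
      -- At a limit both chains are continuous, so the union of the earlier embeddings is defined on
      -- all of `M i`.
      obtain ⟨g, hg, hgf⟩ := h.exists_limit_embedding hlim (M := M) (M' := M i)
        (N := fun j => (t j).1) (f := fun j => (t j).2) (N' := N')
        (fun j l hjl hl => hMle j l hjl (hl.trans hi)) (fun j hj => hMle j i hj.le hi)
        (hMU i hi hlim) hle (fun j hj => (ht j hj).2.1) (by
          intro j l hjl hl x hx
          rcases hjl.lt_or_eq with hjl | rfl
          · exact ((ht l hl).2.2.2.1 ⟨j, hjl⟩).2 x hx
          · rfl)
      refine ⟨(N', g), ?_, hg, fun h' => absurd h' h0i.ne', fun j => ⟨hle j j.2, hgf j j.2⟩,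
        fun _ => ?_, fun j _ hj => ?_⟩
      · refine le_antisymm ?_ ?_
        · unfold card
          rw [hU]
          exact hcard
        · rw [← (ht 0 h0i).1]
          exact h.card_mono (hle 0 h0i)
      · rw [hU, Set.biUnion_eq_iUnion]
      · exact absurd (hj ▸ hlim) (Order.not_isSuccLimit_succ _))
  have hNle : ∀ i j, i ≤ j → j < Order.succ δ → s.cls.le (t i).1 (t j).1 := by
    intro i j hij hj
    rcases hij.lt_or_eq with hij | rfl
    · exact ((ht j hj).2.2.2.1 ⟨i, hij⟩).1
    · exact h.refl (h.mem_right (ht i hj).2.1.choose_spec.2)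
  have hcoh : ∀ i j, i ≤ j → j < Order.succ δ → ∀ x ∈ (M i).carrier, (t j).2 x = (t i).2 x := by
    intro i j hij hj
    rcases hij.lt_or_eq with hij | rfl
    · exact ((ht j hj).2.2.2.1 ⟨i, hij⟩).2
    · exact fun _ _ => rfl
  have ht0 : t 0 = (N, id) := (ht 0 h0).2.2.1 rfl
  have hemb : ∀ i < Order.succ δ, s.cls.IsLeEmbedding (t i).2 (M i) (t i).1 :=
    fun i hi => (ht i hi).2.1
  have : Nonempty (Model τ) := ⟨N⟩
  choose! Q hQ hQle using hemb
  have hQδ : ∀ i < Order.succ δ, IsIso (t δ).2 (M i) (Q i) := fun i hi =>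
    (hQ i hi).congr fun x hx => (hcoh i δ (Order.lt_succ_iff.1 hi) hδδ x hx).symm
  have hQQ : ∀ i j, i ≤ j → j < Order.succ δ → s.cls.le (Q i) (Q j) := fun i j hij hj =>
    h.iso_le (hQδ j hj) (hQδ i (hij.trans_lt hj)) (hMle i j hij hj)
  have hQcont : s.cls.IsContinuous (Order.succ δ) Q := by
    refine ⟨⟨fun i hi => h.mem_left (hQle i hi), hQQ⟩, fun j hj hl => ?_⟩
    rw [IsUnionBelow, (hQδ j hj).image_eq, hMU j hj hl, Set.image_iUnion₂]
    exact Set.iUnion₂_congr fun i hi => (hQδ i ((Set.mem_Iio.1 hi).trans hj)).image_eq.symm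
  -- `Q i` is the range of the `i`-th embedding. A point missed by all of them would have a basic
  -- type over `Q k` at the stage `k` reserved for it.
  have hfull : Q δ = (t δ).1 := by
    by_contra hne
    obtain ⟨a, haN, haQ, hbs⟩ := s.bs_density _ _ (hQle δ hδδ) hne
    obtain ⟨i₀, hi₀, hloc⟩ := s.nf_local δ Q _ a hδlim hQcont (hQle δ hδδ) haN hbs
    rw [(ht δ hδδ).2.2.2.2.1 hδlim] at haN
    obtain ⟨⟨j, hj⟩, haj⟩ := Set.mem_iUnion.1 haN
    -- Choose a block starting after `a` has appeared and after local character has taken effect;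
    -- length `χ·ω` leaves such a block.
    obtain ⟨n, hn, hmax⟩ := (hmulω (max i₀ j)).1 (max_lt hi₀ hj)
    have hnδ : χ.ord * n < δ := by
      refine (hmulω _).2 ⟨Order.succ n, Ordinal.isSuccLimit_omega0.succ_lt hn, ?_⟩
      exact mul_lt_mul_of_pos_left (Order.lt_succ n) (pos_iff_ne_zero.2 hχ0)
    have han : a ∈ (t (χ.ord * n)).1.carrier :=
      h.subset (hNle j _ ((le_max_right _ _).trans hmax.le) (hnδ.trans hδδ)) haj
    obtain ⟨r, hr, her⟩ := he _ (ht _ (hnδ.trans hδδ)).1 a han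
    have hdiv : (χ.ord * n + r) / χ.ord = n := by
      rw [Ordinal.mul_add_div _ hχ0, Ordinal.div_eq_zero_of_lt hr, add_zero]
    have hmod : (χ.ord * n + r) % χ.ord = r := by
      rw [Ordinal.mul_add_mod_self, Ordinal.mod_eq_of_lt hr]
    have hnk : χ.ord * n ≤ χ.ord * n + r := le_self_add
    have hkδ : χ.ord * n + r < δ := by
      refine (hmulω _).2 ⟨Order.succ n, Ordinal.isSuccLimit_omega0.succ_lt hn, ?_⟩
      rw [Ordinal.mul_succ]
      exact (add_lt_add_iff_left _).2 hr
    generalize hk : χ.ord * n + r = k at *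
    have hkδ' := hkδ.trans hδδ
    have hskδ : Order.succ k < Order.succ δ := Order.succ_lt_succ hkδ
    have hak := h.subset (hNle _ _ hnk hkδ') han
    have hnf := hloc k ((le_max_left _ _).trans (hmax.le.trans hnk)) hkδ
    have hQk := h.refl (h.mem_left (hQle k hkδ'))
    -- Non-forking over `Q k` descends to the type over `Q k` itself, computed in the smaller model
    -- `(t k).1`; in particular that type is basic.
    have hnf' := s.nf_mono (Q k) (Q k) (Q k) (Q δ) (t δ).1 (t δ).1 (t k).1 a hQk hQk
      (hQQ k δ hkδ.le hδδ) (hQle δ hδδ) (h.refl (h.mem_right (hQle δ hδδ)))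
      (hNle k δ hkδ.le hδδ) (h.subset (hQle k hkδ')) hak hnf
    have hbsk := (s.nf_dom (hnf'.2.1 hnf'.1)).2.2.2.2.1
    have hlt : χ.ord * n < Order.succ k := Order.lt_succ_iff.2 hnk
    have := (ht _ hskδ).2.2.2.2.2 ⟨k, Order.lt_succ k⟩ ⟨χ.ord * n, hlt⟩ rfl
      (by simp only [hdiv]) (Q k) (hQ k hkδ')
    simp only [hmod, her] at this
    obtain ⟨y, hy, hya⟩ := this hak hbsk
    apply haQ
    rw [← hya, ← hcoh _ δ (Order.lt_succ_iff.1 hskδ) hδδ y hy]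
    exact h.subset (hQQ _ δ (Order.lt_succ_iff.1 hskδ) hδδ) ((hQδ _ hskδ).mapsTo hy)
  have hiso : IsIso (t δ).2 (M δ) (t δ).1 := hfull ▸ hQ δ hδδ
  obtain ⟨g, hg, hgf, -⟩ := hiso.exists_inv
  have hN0 : s.cls.le N (t δ).1 := by
    have := hNle 0 δ zero_le hδδ
    rwa [ht0] at this
  refine ⟨g, h.restrict (h.isLeEmbedding_of_isIso (h.mem_right hN0) hg) hN0, fun x hx => ?_⟩
  have hx' := hcoh 0 δ zero_le hδδ x hx
  rw [ht0] at hx'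
  have := hgf x (h.subset (hMle 0 δ zero_le hδδ) hx)
  rwa [hx'] at this

/-- Every model has a universal extension of the same cardinality. -/
theorem exists_isUniversalOver {M : Model τ} (hM : s.cls.K M) :
    ∃ N, s.cls.IsUniversalOver M N := by
  have h := s.cls_ess
  have hinf := h.aleph0_le_card hM
  have hδc : (M.card.ord * Ordinal.omega0).card ≤ M.card := by
    rw [Ordinal.card_mul, Cardinal.card_ord, Ordinal.card_omega0]
    exact Cardinal.mul_le_of_le hinf le_rfl hinf
  have hlim := Cardinal.isSuccLimit_ord (hinf.trans (h.card_lt hM).le)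
  have hδ : Order.succ (M.card.ord * Ordinal.omega0) ≤ mu.ord :=
    -- The length `χ·ω` still has cardinality `χ = ‖M‖`, so the chain never leaves that cardinality.
    Order.succ_le_of_lt (Cardinal.lt_ord.2 (hδc.trans_lt (h.card_lt hM)))
  obtain ⟨m, hm0, hm, hmc, hmS⟩ := h.exists_continuous_chain hM hδ
    (fun _ N N' => ∀ p ∈ s.bs N, ∃ b ∈ N'.carrier, s.cls.ortp b N N' = p)
    fun _ _ N hN => h.exists_realizing s.amalgamation (h.mem_right hN) _
      (s.bs_subset N (h.mem_right hN)) (s.bs_stability N (h.mem_right hN))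
  refine ⟨m (M.card.ord * Ordinal.omega0), ?_⟩
  have := s.isUniversalOver_of_chain hinf hm (fun i hi => ?_) fun i hi => hmS i
    (Order.succ_lt_succ hi)
  · rwa [hm0] at this
  · refine le_antisymm ((hmc i hi).trans ?_) ?_
    · exact Cardinal.add_le_of_le hinf le_rfl
        ((Ordinal.card_le_card (Order.lt_succ_iff.1 hi)).trans hδc)
    · have := h.card_mono (hm.1.2 0 i zero_le hi)
      rwa [hm0] at this

end GoodEssFrame

/-! ### Brimmed extensions and the monster. -/

/-- Serves the case `mu = ∞`, where the union may be a proper class and the union axiom is not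
available. Comparability makes the operations independent of the chosen `i`. With infinite arities a
tuple may lie in no single `M i`; functions then take the default value `c` and relations fail. -/
theorem Model.exists_isSub_union {ι : Type*} (M : ι → Model τ) [Nonempty ι]
    (hne : ∀ i, (M i).carrier.Nonempty) (hM : ∀ i j, (M i).IsSub (M j) ∨ (M j).IsSub (M i)) :
    ∃ C : Model τ, C.carrier = ⋃ i, (M i).carrier ∧ ∀ i, (M i).IsSub C := by
  classical
  obtain ⟨c, hc⟩ := hne (Classical.arbitrary ι)
  have hcC : c ∈ ⋃ i, (M i).carrier := Set.mem_iUnion.2 ⟨_, hc⟩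
  let C : Model τ :=
    { carrier := ⋃ i, (M i).carrier
      fn := fun F y => if hy : ∃ i, ∀ l, (y l : ZFSet) ∈ (M i).carrier then
        ⟨(M hy.choose).fn F fun l => ⟨y l, hy.choose_spec l⟩,
          Set.mem_iUnion.2 ⟨_, Subtype.prop _⟩⟩ else ⟨c, hcC⟩
      rel := fun R y => ∃ i, ∃ hy : ∀ l, (y l : ZFSet) ∈ (M i).carrier,
        (M i).rel R fun l => ⟨y l, hy l⟩ }
  refine ⟨C, rfl, fun i => ⟨fun x hx => Set.mem_iUnion.2 ⟨i, hx⟩, fun _ _ _ _ e => e, ?_, ?_⟩⟩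
  · intro F x y hxy
    have hy : ∃ i, ∀ l, (y l : ZFSet) ∈ (M i).carrier := ⟨i, fun l => hxy l ▸ (x l).2⟩
    have hfn : C.fn F y = ⟨(M hy.choose).fn F fun l => ⟨y l, hy.choose_spec l⟩,
        Set.mem_iUnion.2 ⟨_, Subtype.prop _⟩⟩ := dif_pos hy
    rw [hfn]
    rcases hM i hy.choose with h | h
    · exact h.map_fn F x _ hxy
    · exact (h.map_fn F (fun l => ⟨y l, hy.choose_spec l⟩) x fun l => (hxy l).symm).symm
  · intro R x y hxy
    constructor
    · intro hR
      refine ⟨i, fun l => hxy l ▸ (x l).2, ?_⟩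
      have : x = fun l => ⟨y l, hxy l ▸ (x l).2⟩ := funext fun l => Subtype.ext (hxy l)
      rwa [← this]
    · rintro ⟨j, hy, hR⟩
      rcases hM i j with h | h
      · exact (h.map_rel R x _ hxy).2 hR
      · exact (h.map_rel R (fun l => ⟨y l, hy l⟩) x fun l => (hxy l).symm).1 hR

namespace GoodEssFrame

variable (s : GoodEssFrame τ lam mu)

/-- If `M` were universal over itself, a proper extension of the same size would embed into `M` over
`M`. A new point `x` has image `f x` in `M`, which `f` fixes, so injectivity gives `f x = x`, a
contradiction. -/
theorem ne_of_isUniversalOver {M N : Model τ} (hMN : s.cls.IsUniversalOver M N) : M ≠ N := by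
  rintro rfl
  have h := s.cls_ess
  obtain ⟨hle, -, huniv⟩ := hMN
  have hM := h.mem_left hle
  obtain ⟨R, hMR, hne⟩ := s.no_maximal M hM
  obtain ⟨x, hxR, hxM⟩ : ∃ x ∈ R.carrier, x ∉ M.carrier := by
    by_contra! hcon
    exact hne (h.antisymm hMR (h.le_of_le_of_subset (h.refl (h.mem_right hMR)) hMR hcon))
  obtain ⟨P, hPR, hMP, hxP, hPc⟩ := h.exists_le_card M.carrier {x} (h.mem_right hMR)
    (h.subset hMR) (by simpa using hxR) (h.le_card hM) le_rfl
    (by simpa using Cardinal.one_le_aleph0.trans (h.aleph0_le_card hM))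
  have hMP' := h.le_of_le_of_subset hMR hPR hMP
  obtain ⟨f, hf, hfix⟩ := huniv P hMP' (hPc.antisymm (h.card_mono hMP'))
  have hxP' : x ∈ P.carrier := by simpa using hxP
  have hfx := h.mapsTo hf hxP'
  have := hf.injOn (hMP hfx) hxP' (hfix _ hfx)
  exact hxM (this ▸ hfx)

/-- Every model has a brimmed extension, which moreover is universal over it. -/
theorem exists_isBrimmedOver {M : Model τ} (hM : s.cls.K M) :
    ∃ N, s.cls.IsBrimmedOver M N ∧ s.cls.IsUniversalOver M N := by
  have h := s.cls_ess
  have hinf := h.aleph0_le_card hM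
  have hω : Order.succ Ordinal.omega0 ≤ mu.ord := by
    refine Order.succ_le_of_lt (Cardinal.lt_ord.2 ?_)
    rw [Ordinal.card_omega0]
    exact hinf.trans_lt (h.card_lt hM)
  obtain ⟨m, hm0, ⟨⟨hmK, hmle⟩, hmU⟩, hmc, hmS⟩ := h.exists_continuous_chain hM hω
    (fun _ N N' => s.cls.IsUniversalOver N N') (by
      intro _ _ N hN
      obtain ⟨N', hN'⟩ := s.exists_isUniversalOver (h.mem_right hN)
      exact ⟨N', hN'.1, hN'.2.1, hN'⟩)
  have hlt := Order.lt_succ (Ordinal.omega0 : Ordinal.{u + 1})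
  have hle : s.cls.le M (m Ordinal.omega0) := hm0 ▸ hmle 0 _ zero_le hlt
  have hcard : (m Ordinal.omega0).card = M.card := by
    refine le_antisymm ((hmc _ hlt).trans ?_) (h.card_mono hle)
    rw [Ordinal.card_omega0]
    exact Cardinal.add_le_of_le hinf le_rfl hinf
  -- The regular cardinal of the definition is `ℵ₀`, which is at most `‖M‖` in every case.
  refine ⟨m Ordinal.omega0, ⟨hle, hcard, ℵ₀, Cardinal.isRegular_aleph0, hinf, m, ?_, hm0, ?_, ?_,
    ?_⟩, hle, hcard, ?_⟩
  · rw [Cardinal.ord_aleph0]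
    exact ⟨⟨fun i hi => hmK i (hi.trans hlt), fun i j hij hj => hmle i j hij (hj.trans hlt)⟩,
      fun j hj => hmU j (hj.trans hlt)⟩
  · rw [Cardinal.ord_aleph0]
    exact fun i hi => hmS i (Order.succ_lt_succ hi)
  · rw [Cardinal.ord_aleph0]
    exact hmU _ hlt Ordinal.isSuccLimit_omega0
  · rw [Cardinal.ord_aleph0]
    exact fun i hi => hmle i _ hi.le hlt
  · intro N' hN' hc
    have h1 : Order.succ (0 : Ordinal.{u + 1}) < Ordinal.omega0 :=
      Ordinal.isSuccLimit_omega0.succ_lt Ordinal.omega0_pos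
    have hu := hmS 0 (h1.trans hlt)
    rw [hm0] at hu
    -- `m 1` is already universal over `M`, and `m 1 ≤ m ω`.
    obtain ⟨f, hf, hfix⟩ := hu.2.2 N' hN' hc
    exact ⟨f, h.trans_le hf (hmle _ _ h1.le hlt), hfix⟩

end GoodEssFrame

theorem claimb86 (τ : Vocab.{u}) (lam mu : Cardinal.{u + 1}) (s : GoodEssFrame τ lam mu) :
    ∃ (C : Model τ) (M : Ordinal.{u + 1} → Model τ),
      -- the cardinality of `C` is at most `mu`
      C.card ≤ mu ∧
      -- `C` is the union of the increasing continuous chain `⟨M α : α < mu⟩` of members of `K_𝔰`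
      s.cls.IsContinuous mu.ord M ∧
      AbstractClass.IsUnionBelow mu.ord M C ∧
      (∀ α < mu.ord, (M α).IsSub C) ∧
      -- and also, when `mu ≠ ∞`, its union in `𝔎[𝔰]`
      (mu < Cardinal.univ.{u, u + 1} → s.big.K C ∧ ∀ α < mu.ord, s.big.le (M α) C) ∧
      -- every member of `K_𝔰` embeds into some `M α`
      (∀ N, s.cls.K N → ∃ α < mu.ord, ∃ f, s.cls.IsLeEmbedding f N (M α)) ∧
      -- successors are brimmed
      (∀ α < mu.ord, s.cls.IsBrimmedOver (M α) (M (Order.succ α))) := by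
  have h := s.cls_ess
  -- The superlimit in `lam` only provides a member of the class to start from.
  obtain ⟨M₀, hM₀, -⟩ := s.superlimit lam le_rfl h.lam_lt
  have hinf : ℵ₀ ≤ mu := h.aleph0_le.trans h.lam_lt.le
  have hlim := Cardinal.isSuccLimit_ord hinf
  obtain ⟨M, -, hM, -, hMS⟩ := h.exists_continuous_chain hM₀ le_rfl
    (fun _ N N' => s.cls.IsBrimmedOver N N' ∧ s.cls.IsUniversalOver N N') (by
      intro _ _ N hN
      obtain ⟨N', hN', hu⟩ := s.exists_isBrimmedOver (h.mem_right hN)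
      exact ⟨N', hu.1, hu.2.1, hN', hu⟩)
  have hMS' : ∀ α < mu.ord, s.cls.IsBrimmedOver (M α) (M (Order.succ α)) ∧
      s.cls.IsUniversalOver (M α) (M (Order.succ α)) := fun α hα => hMS α (hlim.succ_lt hα)
  obtain ⟨⟨hMK, hMle⟩, hMU⟩ := id hM
  have hcard : #(⋃ i ∈ Set.Iio mu.ord, (M i).carrier : Set ZFSet.{u}) ≤ mu := by
    refine (Cardinal.mk_biUnion_Iio_le _ _ mu fun i hi => (h.card_lt (hMK i hi)).le).trans ?_
    rw [Cardinal.card_ord]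
    exact Cardinal.mul_le_of_le hinf le_rfl le_rfl
  -- Each successor adds a new point, and these points are distinct for distinct stages below `α`.
  have hcardM : ∀ α < mu.ord, α.card ≤ (M α).card := by
    intro α hα
    have hnew : ∀ β : Set.Iio α, ∃ x ∈ (M (Order.succ β.1)).carrier, x ∉ (M β).carrier := by
      rintro ⟨β, hβ⟩
      have hβμ := (Set.mem_Iio.1 hβ).trans hα
      by_contra! hcon
      have hu := (hMS' β hβμ).2
      exact s.ne_of_isUniversalOver hu (h.antisymm hu.1
        (h.le_of_le_of_subset (h.refl (h.mem_right hu.1)) hu.1 hcon))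
    choose x hx hxn using hnew
    have hsucc : ∀ β : Set.Iio α, Order.succ β.1 ≤ α := fun β => Order.succ_le_of_lt β.2
    have hne : ∀ β γ : Set.Iio α, β < γ → x β ≠ x γ := by
      intro β γ hβγ heq
      refine hxn γ (heq ▸ ?_)
      exact h.subset (hMle _ _ (Order.succ_le_of_lt hβγ) (γ.2.trans hα)) (hx β)
    have hinj : Function.Injective fun β : Set.Iio α =>
        (⟨x β, h.subset (hMle _ α (hsucc β) hα) (hx β)⟩ : (M α).carrier) := by
      intro β γ hβγ
      have heq : x β = x γ := congrArg Subtype.val hβγ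
      rcases lt_trichotomy β γ with hlt | heq' | hlt
      · exact absurd heq (hne _ _ hlt)
      · exact heq'
      · exact absurd heq.symm (hne _ _ hlt)
    have hle := Cardinal.lift_mk_le_lift_mk_of_injective hinj
    rw [Cardinal.mk_Iio_ordinal, Cardinal.lift_lift] at hle
    exact Cardinal.lift_le.1 hle
  have hemb : ∀ N, s.cls.K N → ∃ α < mu.ord, ∃ f, s.cls.IsLeEmbedding f N (M α) := by
    intro N hN
    have hα : N.card.ord < mu.ord := Cardinal.ord_lt_ord.2 (h.card_lt hN)
    have hNα : N.card ≤ (M N.card.ord).card := by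
      simpa using hcardM _ hα
    have hMα := hMK _ hα
    obtain ⟨R, f₁, f₂, hf₁, hf₂⟩ := s.jointEmbedding N (M N.card.ord) hN hMα
    obtain ⟨g, R', hg, hle, -⟩ := h.exists_rename hMα hf₂
    have hR := h.mem_right hf₁.choose_spec.2
    obtain ⟨P, -, hMP, hP, hPc⟩ := h.exists_shrink hle
      (h.comp (h.isLeEmbedding_of_isIso hR hg) hf₁) rfl hNα
    obtain ⟨f, hf, -⟩ := (hMS' _ hα).2.2.2 P hMP hPc
    exact ⟨_, hlim.succ_lt hα, _, h.comp hf hP⟩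
  have hbig : ∀ {N N'}, s.cls.le N N' → s.big.le N N' := by
    intro N N' hNN'
    rw [s.cls_eq] at hNN'
    exact hNN'.1
  -- The union may have size exactly `mu`, so for `mu < ∞` it is taken in `s.big`, which has no
  -- bound `mu`; otherwise it is formed by hand.
  by_cases hμ : mu < Cardinal.univ.{u, u + 1}
  · obtain ⟨C, ⟨hC, hCU, hCle⟩, -⟩ := s.big_ess.union mu.ord M hlim
      ⟨fun i hi => s.big_ess.mem_left (hbig (h.refl (hMK i hi))),
        fun i j hij hj => hbig (hMle i j hij hj)⟩ (hcard.trans_lt hμ)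
    refine ⟨C, M, ?_, hM, hCU, fun α hα => s.big_ess.isSub (hCle α hα), fun _ => ⟨hC, hCle⟩, hemb,
      fun α hα => (hMS' α hα).1⟩
    unfold Model.card
    rw [hCU]
    exact hcard
  · have : Nonempty (Set.Iio mu.ord) := ⟨⟨0, hlim.bot_lt⟩⟩
    obtain ⟨C, hC, hCs⟩ := Model.exists_isSub_union (fun i : Set.Iio mu.ord => M i)
      (fun i => by
        have : #(M i).carrier ≠ 0 :=
          (Cardinal.aleph0_pos.trans_le (h.aleph0_le_card (hMK i i.2))).ne'
        exact Set.nonempty_coe_sort.1 (Cardinal.mk_ne_zero_iff.1 this))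
      (fun i j => (le_total i j).imp (fun hij => h.isSub (hMle i j hij j.2))
        fun hij => h.isSub (hMle j i hij i.2))
    have hCU : IsUnionBelow mu.ord M C := by
      rw [IsUnionBelow, hC, Set.biUnion_eq_iUnion]
    refine ⟨C, M, ?_, hM, hCU, fun α hα => hCs ⟨α, hα⟩, fun h' => absurd h' hμ, hemb,
      fun α hα => (hMS' α hα).1⟩
    unfold Model.card
    rw [hCU]
    exact hcard
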